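/- All graphs are finite and simple. For a graph $G$ with at least one vertex, let $\rho(G)$ be the maximum of $|E(G')|/|V(G')|$ over all subgraphs $G'$ of $G$ with at least one vertex. A random $k$-fold cover $\mathcal{H}(G,k)=(L,H)$ of $G$ is obtained as follows: $L(v)=\{(v,i) : 1\le i\le k\}$ for each $v\in V(G)$, and $H$ is the graph with vertex set $\bigcup_{v} L(v)$ whose edges form, for each edge $uv$ of $G$, a perfect matching between $L(u)$ and $L(v)$; these matchings are chosen independently and uniformly at random among the $k!$ perfect matchings, and $H$ has no other edges. We say that $G$ is $\mathcal{H}(G,k)$-colorable if there is a set of vertices, independent in $H$, that contains exactly one vertex of each $L(v)$, and we write $p(G,k)=\mathbb{P}(G\text{ is }\mathcal{H}(G,k)\text{-colorable})$. Let $\mathcal{G}=(G_\lambda)_{\lambda\in\mathbb{N}}$ be a sequence of graphs. A function $t\colon\mathbb{N}\to\mathbb{R}$ is a DP-threshold function for $\mathcal{G}$ if for every sequence $(k_\lambda)_{\lambda\in\mathbb{N}}$ of non-negative integers, $k_\lambda=o(t(\lambda))$ implies $\lim_{\lambda\to\infty}p(G_\lambda,k_\lambda)=0$, and $t(\lambda)=o(k_\lambda)$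 implies $\lim_{\lambda\to\infty}p(G_\lambda,k_\lambda)=1$. It is a sharp DP-threshold function for $\mathcal{G}$ if for every $\epsilon>0$ and every such sequence $(k_\lambda)$, we have $\lim_{\lambda\to\infty}p(G_\lambda,k_\lambda)=0$ whenever $k_\lambda\le(1-\epsilon)t(\lambda)$ for all large enough $\lambda$, and $\lim_{\lambda\to\infty}p(G_\lambda,k_\lambda)=1$ whenever $k_\lambda\ge(1+\epsilon)t(\lambda)$ for all large enough $\lambda$. **Theorem.** Let $\mathcal{G}=(G_\lambda)_{\lambda\in\mathbb{N}}$ be a sequence of graphs such that $|V(G_\lambda)|\to\infty$ and $\rho(G_\lambda)\to\infty$ as $\lambda\to\infty$, and let $t_{\mathcal{G}}(\lambda)=\rho(G_\lambda)/\ln\rho(G_\lambda)$. If $$\lim_{\lambda\to\infty}\frac{\ln\rho(G_\lambda)}{\ln\ln|V(G_\lambda)|}=\infty,$$ then $t_{\mathcal{G}}$ is a DP-threshold function for $\mathcal{G}$. Furthermore, if $$\lim_{\lambda\to\infty}\frac{\ln\rho(G_\lambda)}{\ln|V(G_\lambda)|}=1,$$ then $t_{\mathcal{G}}$ is a sharp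 DP-threshold function for $\mathcal{G}$. -/

import Mathlib

open Filter Topology Asymptotics

universe u w

/-- The density `|E(G')| / |V(G')|` of a subgraph `G'` of a graph `G`. -/
noncomputable def SimpleGraph.Subgraph.density {V : Type u} {G : SimpleGraph V}
    (G' : G.Subgraph) : ℝ :=
  (G'.edgeSet.ncard : ℝ) / (G'.verts.ncard : ℝ)

/-- The maximum density `ρ(G)`: the largest density of a subgraph of `G` with at least one vertex.
The supremum is attained when `G` is finite and has a vertex (`isGreatest_maxDensity`). -/
noncomputable def SimpleGraph.maxDensity {V : Type u} (G : SimpleGraph V) : ℝ :=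
  sSup {x : ℝ | ∃ G' : G.Subgraph, G'.verts.Nonempty ∧ x = G'.density}

theorem SimpleGraph.isGreatest_maxDensity {V : Type u} [Finite V] [Nonempty V]
    (G : SimpleGraph V) :
    IsGreatest {x : ℝ | ∃ G' : G.Subgraph, G'.verts.Nonempty ∧ x = G'.density} G.maxDensity := by
  have hfin : {x : ℝ | ∃ G' : G.Subgraph, G'.verts.Nonempty ∧ x = G'.density}.Finite := by
    refine (Set.finite_range fun G' : G.Subgraph => G'.density).subset ?_
    rintro x ⟨G', -, rfl⟩
    exact ⟨G', rfl⟩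
  have hne : {x : ℝ | ∃ G' : G.Subgraph, G'.verts.Nonempty ∧ x = G'.density}.Nonempty :=
    ⟨_, ⊤, by simp, rfl⟩
  exact ⟨hne.csSup_mem hfin, fun x hx => le_csSup hfin.bddAbove hx⟩

/-- A DP-cover `(L, H)` of a graph `G`, with `H` a graph on the vertex type `W`. -/
structure DPCover {V : Type u} (G : SimpleGraph V) (W : Type w) where
  /-- The list `L(v)` of a vertex `v`. -/
  list : V → Set W
  /-- The cover graph `H`. -/
  graph : SimpleGraph W
  /-- The lists partition the vertices of `H`. -/
  partition : ∀ x : W, ∃! v : V, x ∈ list v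
  /-- Every list is an independent set of `H`. -/
  indep : ∀ v : V, graph.IsIndepSet (list v)
  /-- Over every edge `uv` of `G` the edges of `H` between `L(u)` and `L(v)` form a matching.
  The ordered pairs `(u, v)` and `(v, u)` are both covered by the quantifiers. -/
  matching : ∀ u v : V, G.Adj u v → ∀ x ∈ list u, ∀ y ∈ list v, ∀ y' ∈ list v,
    graph.Adj x y → graph.Adj x y' → y = y'
  /-- Every edge of `H` lies over an edge of `G`. -/
  edges : ∀ x y : W, graph.Adj x y → ∃ u v : V, G.Adj u v ∧ x ∈ list u ∧ y ∈ list v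

/-- A transversal contains exactly one vertex from each list. -/
def DPCover.IsTransversal {V : Type u} {G : SimpleGraph V} {W : Type w} (C : DPCover G W)
    (T : Set W) : Prop :=
  ∀ v : V, ∃! x : W, x ∈ T ∧ x ∈ C.list v

/-- `G` is colorable from the cover `C = (L, H)` if there is a transversal that is
independent in `H`. -/
def DPCover.Colorable {V : Type u} {G : SimpleGraph V} {W : Type w} (C : DPCover G W) : Prop :=
  ∃ T : Set W, C.IsTransversal T ∧ C.graph.IsIndepSet T

/-- The graph `H_σ` on `V × [k]`. The linear order on `V` is the enumeration `v₁, …, vₙ`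
that orients the edges: for an edge `e = uv` of `G` with `u < v`, the vertex `(u, i)` is joined
to `(v, σ_e i)` for every `i`. -/
def permCoverGraph {V : Type u} [LinearOrder V] (G : SimpleGraph V) {k : ℕ}
    (σ : G.edgeSet → Equiv.Perm (Fin k)) : SimpleGraph (V × Fin k) where
  Adj x y :=
    (∃ h : G.Adj x.1 y.1, x.1 < y.1 ∧ y.2 = σ ⟨s(x.1, y.1), h⟩ x.2) ∨
      (∃ h : G.Adj y.1 x.1, y.1 < x.1 ∧ x.2 = σ ⟨s(y.1, x.1), h⟩ y.2)
  symm := ⟨fun _ _ h => h.symm⟩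
  loopless := ⟨fun x h => by
    rcases h with ⟨h, -⟩ | ⟨h, -⟩ <;> exact G.loopless.irrefl _ h⟩

/-- The full `k`-fold cover `(L, H_σ)` of `G`, with `L(v) = {(v, i) : i ∈ [k]}`. -/
def permCover {V : Type u} [LinearOrder V] (G : SimpleGraph V) {k : ℕ}
    (σ : G.edgeSet → Equiv.Perm (Fin k)) : DPCover G (V × Fin k) where
  list v := {x | x.1 = v}
  graph := permCoverGraph G σ
  partition x := ⟨x.1, rfl, fun _ h => h.symm⟩
  indep v := by
    intro x hx y hy _ hadj
    have hxy : x.1 = y.1 := (show x.1 = v from hx).trans (show y.1 = v from hy).symm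
    rcases hadj with ⟨-, h, -⟩ | ⟨-, h, -⟩
    · exact absurd hxy h.ne
    · exact absurd hxy h.ne'
  matching u v huv := by
    rintro ⟨a, i⟩ ha ⟨b, j⟩ hb ⟨b', j'⟩ hb' h h'
    obtain rfl : a = u := ha
    obtain rfl : b = v := hb
    obtain rfl : b' = b := hb'
    rcases h with ⟨_, hlt, h⟩ | ⟨_, hlt, h⟩ <;> rcases h' with ⟨_, hlt', h'⟩ | ⟨_, hlt', h'⟩
    · exact Prod.ext rfl (h.trans h'.symm)
    · exact absurd hlt hlt'.asymm
    · exact absurd hlt hlt'.asymm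
    · exact Prod.ext rfl (Equiv.injective _ (h.symm.trans h'))
  edges x y h := by
    refine ⟨x.1, y.1, ?_, rfl, rfl⟩
    rcases h with ⟨h, -⟩ | ⟨h, -⟩
    · exact h
    · exact h.symm

/-- Different `σ` give different covers, so that a uniformly random `σ` is the same as a
uniformly random element of the set of all covers `(L, H_σ)`. -/
theorem permCover_injective {V : Type u} [LinearOrder V] (G : SimpleGraph V) (k : ℕ) :
    Function.Injective
      (permCover G : (G.edgeSet → Equiv.Perm (Fin k)) → DPCover G (V × Fin k)) := by
  intro σ τ h
  have hg : permCoverGraph G σ = permCoverGraph G τ := congrArg DPCover.graph h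
  have key : ∀ (a b : V) (hab : G.Adj a b), a < b →
      σ ⟨s(a, b), hab⟩ = τ ⟨s(a, b), hab⟩ := by
    intro a b hab hlt
    ext1 i
    have h1 : (permCoverGraph G σ).Adj (a, i) (b, σ ⟨s(a, b), hab⟩ i) :=
      Or.inl ⟨hab, hlt, rfl⟩
    rw [hg] at h1
    rcases h1 with ⟨_, -, h1⟩ | ⟨_, h1, -⟩
    · exact h1
    · exact absurd hlt h1.asymm
  funext ⟨e, he⟩
  induction e using Sym2.ind with
  | _ a b =>
    have hab : G.Adj a b := he
    rcases lt_trichotomy a b with hlt | heq | hgt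
    · exact key a b hab hlt
    · exact absurd heq hab.ne
    · have hs : (⟨s(a, b), he⟩ : G.edgeSet) = ⟨s(b, a), hab.symm⟩ :=
        Subtype.ext Sym2.eq_swap
      rw [hs]
      exact key b a hab.symm hgt

/-- The probability that `G` is colorable from the random `k`-fold cover `H(G, k)`, that is from
`(L, H_σ)` with `σ` uniform among the `(k!) ^ |E(G)|` families of permutations of `[k]`. -/
noncomputable def dpColorableProb {V : Type u} [LinearOrder V] (G : SimpleGraph V) (k : ℕ) : ℝ :=
  (Nat.card {σ : G.edgeSet → Equiv.Perm (Fin k) // (permCover G σ).Colorable} : ℝ) /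
    (Nat.card (G.edgeSet → Equiv.Perm (Fin k)) : ℝ)

/-- The sequence `G` is `κ`-DP-colorable with high probability. -/
def DPColorableWHP {V : ℕ → Type u} [∀ l, LinearOrder (V l)] (G : ∀ l, SimpleGraph (V l))
    (κ : ℕ → ℕ) : Prop :=
  Tendsto (fun l => dpColorableProb (G l) (κ l)) atTop (𝓝 1)

/-- The sequence `G` is non-`κ`-DP-colorable with high probability. -/
def NonDPColorableWHP {V : ℕ → Type u} [∀ l, LinearOrder (V l)] (G : ∀ l, SimpleGraph (V l))
    (κ : ℕ → ℕ) : Prop :=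
  Tendsto (fun l => dpColorableProb (G l) (κ l)) atTop (𝓝 0)

/-- `t` is a DP-threshold function for the sequence `G`. -/
def IsDPThreshold {V : ℕ → Type u} [∀ l, LinearOrder (V l)] (G : ∀ l, SimpleGraph (V l))
    (t : ℕ → ℝ) : Prop :=
  ∀ κ : ℕ → ℕ,
    ((fun l => (κ l : ℝ)) =o[atTop] t → NonDPColorableWHP G κ) ∧
      (t =o[atTop] (fun l => (κ l : ℝ)) → DPColorableWHP G κ)

/-- `t` is a sharp DP-threshold function for the sequence `G`. -/
def IsSharpDPThreshold {V : ℕ → Type u} [∀ l, LinearOrder (V l)] (G : ∀ l, SimpleGraph (V l))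
    (t : ℕ → ℝ) : Prop :=
  ∀ ε : ℝ, 0 < ε → ∀ κ : ℕ → ℕ,
    ((∀ᶠ l in atTop, (κ l : ℝ) ≤ (1 - ε) * t l) → NonDPColorableWHP G κ) ∧
      ((∀ᶠ l in atTop, (1 + ε) * t l ≤ (κ l : ℝ)) → DPColorableWHP G κ)

/-!
Write `ρ` for the maximum density, `L = log ρ`, and `n` for the number of vertices. Orienting every
edge from its smaller to its larger end turns a random cover into independent uniform permutations
`σ e` on the edges, and an independent transversal into a colouring `f` with
`σ e (f (source)) ≠ f (target)` for every edge (`permCover_colorable_iff`).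

*Few colours.* On the vertex set `A` of a densest subgraph, which spans `ρ |A|` edges, the expected
number of proper colourings is `k ^ |A| * (1 - 1 / k) ^ (ρ |A|) ≤ (k * exp (-ρ / k)) ^ |A|`, and for
`k ≤ (1 - ε) ρ / log ρ` the base is at most a negative power of `ρ` (`dpColorableProb_le_exp`).

*Many colours.* Every subgraph has a vertex of degree at most `2ρ`, so the vertices can be coloured
one by one with at most `d = ⌊2ρ⌋` earlier neighbours each. These forbid independent uniform
colours, which cover all `k` colours with probability at most `(1 - (1 - 1 / k) ^ d) ^ k`
(`uniformProb_forall_exists_le`). If `k ≥ 9 ρ / log ρ` this is at most `exp (-ρ ^ (1 / 2))`, and a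
union bound over `n ≤ exp (ρ ^ (1 / 4))` vertices suffices (`one_sub_exp_le_dpColorableProb`).

*The sharp threshold.* If `ρ = n ^ (1 - o(1))` and `k ≥ (1 + ε) ρ / log ρ`, the second moment method
applies (`one_le_uniformProb_exists_properOn_mul`). Two colourings that agree on the set `A` are
correlated by a factor of about `exp (e(A) / k)`, where `e(A) ≤ min(ρ |A|, |A| ^ 2)`. For
`|A| ≤ ρ ^ (1 / 3)` this is `1 + o(1)`, and the larger sets contribute a geometric series whose ratio
tends to zero (`mul_exp_min_le_overlapRatio`), so the second moment is asymptotic to the square of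
the first (`one_le_dpColorableProb_mul_secondMomentRatio`).
-/

/-! ### Uniform probability on finite types -/

section Probability

open scoped Classical in
/-- The probability of the event `p` under the uniform distribution on the finite type `Ω`. -/
noncomputable def uniformProb {Ω : Type*} [Fintype Ω] (p : Ω → Prop) : ℝ :=
  (Finset.univ.filter p).card / Fintype.card Ω

theorem uniformProb_eq_card {Ω : Type*} [Fintype Ω] (p : Ω → Prop) [DecidablePred p] :
    uniformProb p = (Finset.univ.filter p).card / Fintype.card Ω := by
  unfold uniformProb
  congr!

open scoped Classical in
theorem uniformProb_eq_sum {Ω : Type*} [Fintype Ω] (p : Ω → Prop) :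
    uniformProb p = (∑ ω, if p ω then (1 : ℝ) else 0) / Fintype.card Ω := by
  simp [uniformProb]

theorem uniformProb_eq_natCard {Ω : Type*} [Fintype Ω] (p : Ω → Prop) :
    uniformProb p = (Nat.card {ω // p ω} : ℝ) / Nat.card Ω := by
  classical
  rw [uniformProb_eq_card, Nat.card_eq_fintype_card, Nat.card_eq_fintype_card, Fintype.card_subtype]

theorem uniformProb_nonneg {Ω : Type*} [Fintype Ω] (p : Ω → Prop) : 0 ≤ uniformProb p := by
  unfold uniformProb; positivity

theorem uniformProb_mono {Ω : Type*} [Fintype Ω] {p q : Ω → Prop} (h : ∀ ω, p ω → q ω) :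
    uniformProb p ≤ uniformProb q := by
  unfold uniformProb
  gcongr with ω
  exact h ω

theorem uniformProb_le_one {Ω : Type*} [Fintype Ω] (p : Ω → Prop) : uniformProb p ≤ 1 := by
  unfold uniformProb
  refine div_le_one_of_le₀ ?_ (by positivity)
  exact_mod_cast Finset.card_le_univ _

theorem uniformProb_true {Ω : Type*} [Fintype Ω] [Nonempty Ω] :
    uniformProb (fun _ : Ω => True) = 1 := by
  simp [uniformProb]

theorem uniformProb_false {Ω : Type*} [Fintype Ω] {p : Ω → Prop} (h : ∀ ω, ¬ p ω) :
    uniformProb p = 0 := by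
  simp [uniformProb, h]

theorem uniformProb_not {Ω : Type*} [Fintype Ω] [Nonempty Ω] (p : Ω → Prop) :
    uniformProb (fun ω => ¬ p ω) = 1 - uniformProb p := by
  classical
  have hN : (Fintype.card Ω : ℝ) ≠ 0 := by exact_mod_cast Fintype.card_ne_zero
  have h := Finset.card_filter_add_card_filter_not (s := (Finset.univ : Finset Ω)) p
  rw [Finset.card_univ] at h
  simp only [uniformProb_eq_card]
  rw [eq_sub_iff_add_eq, ← add_div, div_eq_one_iff_eq hN, add_comm]
  exact_mod_cast h

theorem uniformProb_or_add_and {Ω : Type*} [Fintype Ω] (p q : Ω → Prop) :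
    uniformProb (fun ω => p ω ∨ q ω) + uniformProb (fun ω => p ω ∧ q ω) =
      uniformProb p + uniformProb q := by
  classical
  simp only [uniformProb_eq_card]
  rw [← add_div, ← add_div, Finset.filter_or, Finset.filter_and]
  congr 1
  exact_mod_cast Finset.card_union_add_card_inter _ _

/-- Inclusion–exclusion for the complements of two events. -/
theorem uniformProb_not_and_not {Ω : Type*} [Fintype Ω] [Nonempty Ω] (p q : Ω → Prop) :
    uniformProb (fun ω => ¬ p ω ∧ ¬ q ω) =
      1 - uniformProb p - uniformProb q + uniformProb (fun ω => p ω ∧ q ω) := by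
  have h := uniformProb_or_add_and p q
  have h' := uniformProb_not (fun ω => p ω ∨ q ω)
  simp only [not_or] at h'
  linarith

theorem uniformProb_exists_le_sum {Ω ι : Type*} [Fintype Ω] [Fintype ι] (p : ι → Ω → Prop) :
    uniformProb (fun ω => ∃ i, p i ω) ≤ ∑ i, uniformProb (p i) := by
  classical
  simp only [uniformProb_eq_card]
  rw [← Finset.sum_div]
  gcongr
  have : (Finset.univ.filter fun ω => ∃ i, p i ω) =
      Finset.univ.biUnion fun i => Finset.univ.filter (p i) := by
    ext; simp
  rw [this]
  exact_mod_cast Finset.card_biUnion_le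

/-- The coordinates of a uniform point of a product `ι → α` are independent and uniform. -/
theorem uniformProb_pi {ι α : Type*} [Fintype ι] [DecidableEq ι] [Fintype α]
    (p : ι → α → Prop) :
    uniformProb (fun σ : ι → α => ∀ i, p i (σ i)) = ∏ i, uniformProb (p i) := by
  classical
  simp only [uniformProb_eq_card]
  have : (Finset.univ.filter fun σ : ι → α => ∀ i, p i (σ i)) =
      Fintype.piFinset fun i => Finset.univ.filter (p i) := by
    ext; simp
  rw [this, Fintype.card_piFinset, Finset.prod_div_distrib]
  simp

theorem uniformProb_coord {ι α : Type*} [Fintype ι] [DecidableEq ι] [Fintype α] [Nonempty α]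
    (p : α → Prop) (i : ι) :
    uniformProb (fun σ : ι → α => p (σ i)) = uniformProb p := by
  have h := uniformProb_pi (fun (j : ι) (a : α) => j = i → p a)
  simp only [forall_eq] at h
  rw [h, Finset.prod_eq_single i]
  · simp
  · intro j _ hj
    simp [hj, uniformProb_true]
  · simp

/-- Resampling the coordinates in `D` does not change the distribution: the involution
`(σ, τ) ↦ (D.piecewise τ σ, D.piecewise σ τ)` exchanges the old and the new coordinates. -/
theorem uniformProb_resample {ι α : Type*} [Fintype ι] [DecidableEq ι] [Fintype α] [Nonempty α]
    (D : Finset ι) (p : (ι → α) → Prop) :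
    uniformProb p =
      (∑ σ : ι → α, uniformProb fun τ : ι → α => p (D.piecewise τ σ)) /
        Fintype.card (ι → α) := by
  classical
  have hN : (Fintype.card (ι → α) : ℝ) ≠ 0 := by exact_mod_cast Fintype.card_ne_zero
  let Φ : (ι → α) × (ι → α) → (ι → α) × (ι → α) :=
    fun x => (D.piecewise x.2 x.1, D.piecewise x.1 x.2)
  have hΦ : Function.Involutive Φ := by
    rintro ⟨σ, τ⟩
    ext i <;> by_cases hi : i ∈ D <;> simp [Φ, hi]
  have key : ∑ σ : ι → α, ∑ τ : ι → α, (if p (D.piecewise τ σ) then (1 : ℝ) else 0) =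
      ∑ σ : ι → α, ∑ _τ : ι → α, (if p σ then (1 : ℝ) else 0) := by
    rw [← Fintype.sum_prod_type', ← Fintype.sum_prod_type']
    exact Equiv.sum_comp (hΦ.toPerm Φ)
      (fun x : (ι → α) × (ι → α) => if p x.1 then (1 : ℝ) else 0)
  simp only [uniformProb_eq_sum]
  rw [← Finset.sum_div, key]
  simp only [Finset.sum_const, Finset.card_univ, nsmul_eq_mul, ← Finset.mul_sum]
  field_simp

end Probability

/-! ### A uniform random permutation -/

section Permutations

theorem uniformProb_perm_apply {k : ℕ} (a b : Fin k) :
    uniformProb (fun π : Equiv.Perm (Fin k) => π a = b) = 1 / k := by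
  classical
  have hk : (k : ℝ) ≠ 0 := by
    have := a.pos
    positivity
  -- Composing with the transposition of `b` and `c` shows that all values are equally likely.
  have hsymm : ∀ c, (Finset.univ.filter fun π : Equiv.Perm (Fin k) => π a = c).card =
      (Finset.univ.filter fun π : Equiv.Perm (Fin k) => π a = b).card := by
    intro c
    refine Finset.card_bijective (fun π => Equiv.swap c b * π) (Group.mulLeft_bijective _) ?_
    intro π
    simp [Equiv.swap_apply_eq_iff]
  have hsum := Finset.card_eq_sum_card_fiberwise (s := (Finset.univ : Finset (Equiv.Perm (Fin k))))
    (t := Finset.univ) (f := fun π => π a) (fun _ _ => by simp)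
  simp only [hsymm, Finset.sum_const, Finset.card_univ, smul_eq_mul, Fintype.card_fin] at hsum
  simp only [uniformProb_eq_card]
  rw [hsum]
  have h0 : Fintype.card (Equiv.Perm (Fin k)) ≠ 0 := Fintype.card_ne_zero
  rw [hsum] at h0
  have h1 : ((Finset.univ.filter fun π : Equiv.Perm (Fin k) => π a = b).card : ℝ) ≠ 0 := by
    exact_mod_cast right_ne_zero_of_mul h0
  push_cast
  rw [div_eq_div_iff (by positivity) hk]
  ring

theorem uniformProb_perm_symm_apply {k : ℕ} (a b : Fin k) :
    uniformProb (fun π : Equiv.Perm (Fin k) => π.symm a = b) = 1 / k := by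
  simp only [Equiv.symm_apply_eq]
  simpa only [eq_comm] using uniformProb_perm_apply b a

theorem uniformProb_perm_apply_two {k : ℕ} {a a' b b' : Fin k} (ha : a ≠ a') (hb : b ≠ b') :
    uniformProb (fun π : Equiv.Perm (Fin k) => π a = b ∧ π a' = b') = 1 / (k * (k - 1)) := by
  classical
  have hsymm : ∀ c ∈ Finset.univ.erase b,
      (Finset.univ.filter fun π : Equiv.Perm (Fin k) => π a = b ∧ π a' = c).card =
      (Finset.univ.filter fun π : Equiv.Perm (Fin k) => π a = b ∧ π a' = b').card := by
    intro c hc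
    have hc : c ≠ b := Finset.ne_of_mem_erase hc
    refine Finset.card_bijective (fun π => Equiv.swap c b' * π) (Group.mulLeft_bijective _) ?_
    intro π
    simp [Equiv.swap_apply_eq_iff, Equiv.swap_apply_of_ne_of_ne hc.symm hb]
  have hsum := Finset.card_eq_sum_card_fiberwise
    (s := (Finset.univ.filter fun π : Equiv.Perm (Fin k) => π a = b))
    (t := Finset.univ.erase b) (f := fun π => π a') (fun π hπ => by
      have hπ : π a = b := by simpa using hπ
      simp only [Finset.coe_erase, Finset.coe_univ, Set.mem_sdiff, Set.mem_univ, true_and,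
        Set.mem_singleton_iff]
      rw [← hπ]
      exact fun h => ha (π.injective h).symm)
  simp only [Finset.filter_filter] at hsum
  rw [Finset.sum_congr rfl hsymm] at hsum
  simp only [Finset.sum_const, Finset.card_erase_of_mem (Finset.mem_univ b), Finset.card_univ,
    smul_eq_mul, Fintype.card_fin] at hsum
  have h1 := uniformProb_perm_apply a b
  rw [uniformProb_eq_card] at h1 ⊢
  have hk : 1 ≤ k := a.pos
  have hk2 : 1 < k := by
    by_contra h
    have : k = 1 := by omega
    subst this
    exact ha (Subsingleton.elim _ _)
  rw [hsum] at h1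
  push_cast [Nat.cast_sub hk] at h1
  have hk' : (k : ℝ) - 1 ≠ 0 := by
    have : (1 : ℝ) < k := by exact_mod_cast hk2
    linarith
  rw [mul_div_assoc] at h1
  rw [← div_div, ← h1]
  field_simp

end Permutations

/-! ### Covering by independent values -/

section Coupon

theorem pow_succ_add_mul_le_add_pow {y z : ℝ} (hy : 0 ≤ y) (hz : 0 ≤ z) (m : ℕ) :
    y ^ (m + 1) + (m + 1) * y ^ m * z ≤ (y + z) ^ (m + 1) := by
  induction m with
  | zero => simp
  | succ m ih =>
    have h1 : 0 ≤ (m + 1) * y ^ m * z * z := by positivity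
    have h2 := mul_le_mul_of_nonneg_right ih (add_nonneg hy hz)
    rw [pow_succ (y + z) (m + 1)]
    refine le_trans ?_ h2
    push_cast
    rw [pow_succ y (m + 1), pow_succ y m]
    linarith

/-- Independent uniform coordinates, read through maps `φ e` that take each value with
probability at most `1 / k`, hit every element of `J` with probability at most what it would be
if the `|J|` events were independent. -/
theorem uniformProb_forall_exists_le {ι α β : Type*} [Fintype ι] [DecidableEq ι] [Fintype α]
    [Nonempty α] [DecidableEq β] {k : ℝ} (hk : 1 ≤ k) (φ : ι → α → β) (D : Finset ι)
    (hφ : ∀ e ∈ D, ∀ j, uniformProb (fun a => φ e a = j) ≤ 1 / k) (J : Finset β) :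
    uniformProb (fun σ : ι → α => ∀ j ∈ J, ∃ e ∈ D, φ e (σ e) = j) ≤
      (1 - (1 - 1 / k) ^ D.card) ^ J.card := by
  classical
  induction D using Finset.induction_on generalizing J with
  | empty =>
    rcases J.eq_empty_or_nonempty with rfl | ⟨j, hj⟩
    · simpa using uniformProb_le_one _
    · rw [uniformProb_false]
      · simp
      · intro σ h
        simpa using h j hj
  | insert e D he ih =>
    have hkp : 0 < k := by linarith
    have hk1 : 1 / k ≤ 1 := (div_le_one hkp).2 hk
    have hk0 : 0 < 1 / k := by positivity
    set x := (1 - 1 / k) ^ D.card with hx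
    have hx0 : 0 ≤ x := pow_nonneg (by linarith) _
    have hx1 : x ≤ 1 := pow_le_one₀ (by linarith) (by linarith)
    have hN : (0 : ℝ) < Fintype.card (ι → α) := by exact_mod_cast Fintype.card_pos
    -- Condition on coordinate `e`, which takes care of the element `φ e (σ e)`.
    have hin : ∀ σ : ι → α, uniformProb (fun τ : ι → α =>
        ∀ j ∈ J, ∃ e' ∈ insert e D, φ e' (D.piecewise τ σ e') = j) ≤
        (1 - x) ^ J.card + (if φ e (σ e) ∈ J then 1 else 0) *
          ((1 - x) ^ (J.card - 1) - (1 - x) ^ J.card) := by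
      intro σ
      have h1 := (uniformProb_mono (p := fun τ : ι → α =>
        ∀ j ∈ J, ∃ e' ∈ insert e D, φ e' (D.piecewise τ σ e') = j) (q := fun τ : ι → α =>
        ∀ j ∈ J.erase (φ e (σ e)), ∃ e' ∈ D, φ e' (τ e') = j) (by
          intro τ h j hj
          obtain ⟨hj1, hj2⟩ := Finset.mem_erase.1 hj
          obtain ⟨e', he', h'⟩ := h j hj2
          rcases Finset.mem_insert.1 he' with rfl | he'
          · rw [Finset.piecewise_eq_of_notMem _ _ _ he] at h'
            exact absurd h'.symm hj1
          · rw [Finset.piecewise_eq_of_mem _ _ _ he'] at h'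
            exact ⟨e', he', h'⟩)).trans
        (ih (fun e' he' => hφ e' (Finset.mem_insert_of_mem he')) (J.erase (φ e (σ e))))
      by_cases hm : φ e (σ e) ∈ J
      · rw [Finset.card_erase_of_mem hm] at h1
        simpa [hm] using h1
      · rw [Finset.erase_eq_of_notMem hm] at h1
        simpa [hm] using h1
    have hJ : uniformProb (fun σ : ι → α => φ e (σ e) ∈ J) ≤ J.card * (1 / k) := by
      rw [uniformProb_coord (fun a => φ e a ∈ J) e]
      refine (uniformProb_mono (q := fun a => ∃ j : J, φ e a = j)
        (fun a h => ⟨⟨_, h⟩, rfl⟩)).trans ((uniformProb_exists_le_sum _).trans ?_)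
      refine (Finset.sum_le_sum fun j _ => hφ e (Finset.mem_insert_self _ _) j.1).trans ?_
      simp
    have hmono : 0 ≤ (1 - x) ^ (J.card - 1) - (1 - x) ^ J.card :=
      sub_nonneg.2 (pow_le_pow_of_le_one (by linarith) (by linarith) (Nat.sub_le _ _))
    rw [uniformProb_resample D]
    calc _ ≤ (∑ σ : ι → α, ((1 - x) ^ J.card + (if φ e (σ e) ∈ J then 1 else 0) *
          ((1 - x) ^ (J.card - 1) - (1 - x) ^ J.card))) / Fintype.card (ι → α) := by
          gcongr with σ
          exact hin σ
      _ = (1 - x) ^ J.card + uniformProb (fun σ : ι → α => φ e (σ e) ∈ J) *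
          ((1 - x) ^ (J.card - 1) - (1 - x) ^ J.card) := by
          rw [uniformProb_eq_sum, Finset.sum_add_distrib, ← Finset.sum_mul, Finset.sum_const,
            Finset.card_univ, nsmul_eq_mul, add_div, mul_div_cancel_left₀ _ hN.ne',
            div_mul_eq_mul_div]
          congr!
      _ ≤ (1 - x) ^ J.card + J.card * (1 / k) *
          ((1 - x) ^ (J.card - 1) - (1 - x) ^ J.card) := by gcongr
      _ ≤ ((1 - x) + 1 / k * x) ^ J.card := by
          rcases Nat.eq_zero_or_pos J.card with h0 | h0
          · simp [h0]
          · obtain ⟨m, hm⟩ : ∃ m, J.card = m + 1 := ⟨J.card - 1, by omega⟩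
            rw [hm]
            refine le_trans (le_of_eq ?_)
              (pow_succ_add_mul_le_add_pow (sub_nonneg.2 hx1) (mul_nonneg hk0.le hx0) m)
            push_cast
            ring
      _ = _ := by
          rw [Finset.card_insert_of_notMem he, pow_succ, ← hx]
          congr 1
          ring
end Coupon

/-! ### Proper colourings for random permutations on oriented edges -/

section Oriented

variable {V E : Type*} [DecidableEq V] [Fintype E] [DecidableEq E] {k : ℕ}

/-- The edges with both ends in `A`, for a graph given by the source map `s` and the target map
`t` on its edge set `E`. -/
def edgesIn (s t : E → V) (A : Finset V) : Finset E :=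
  Finset.univ.filter fun e => s e ∈ A ∧ t e ∈ A

/-- The colouring `f` satisfies the constraints that the permutations `σ` impose on the edges with
both ends in `A`: on the edge `e` the colour `i` of the source forbids the colour `σ e i` of the
target. -/
def ProperOn (s t : E → V) (A : Finset V) (σ : E → Equiv.Perm (Fin k)) (f : V → Fin k) : Prop :=
  ∀ e, s e ∈ A → t e ∈ A → σ e (f (s e)) ≠ f (t e)

theorem uniformProb_perm_ne (a b : Fin k) :
    uniformProb (fun π : Equiv.Perm (Fin k) => π a ≠ b) = 1 - 1 / k := by
  rw [← uniformProb_perm_apply a b]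
  exact uniformProb_not _

/-- The first moment bound: a union bound over the colourings of `A`. -/
theorem uniformProb_exists_properOn_le (s t : E → V) (A : Finset V) :
    uniformProb (fun σ : E → Equiv.Perm (Fin k) => ∃ f, ProperOn s t A σ f) ≤
      (k : ℝ) ^ A.card * (1 - 1 / k) ^ (edgesIn s t A).card := by
  have h1 := (uniformProb_mono (p := fun σ : E → Equiv.Perm (Fin k) => ∃ f, ProperOn s t A σ f)
    (q := fun σ => ∃ f : A → Fin k, ∀ e, ∀ h : s e ∈ A ∧ t e ∈ A,
      σ e (f ⟨s e, h.1⟩) ≠ f ⟨t e, h.2⟩)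
    (fun σ ⟨f, hf⟩ => ⟨fun v => f v, fun e h => hf e h.1 h.2⟩)).trans
    (uniformProb_exists_le_sum _)
  refine h1.trans (le_of_eq ?_)
  have h2 : ∀ f : A → Fin k, uniformProb (fun σ : E → Equiv.Perm (Fin k) =>
      ∀ e, ∀ h : s e ∈ A ∧ t e ∈ A, σ e (f ⟨s e, h.1⟩) ≠ f ⟨t e, h.2⟩) =
      (1 - 1 / k) ^ (edgesIn s t A).card := by
    intro f
    rw [uniformProb_pi (fun e (π : Equiv.Perm (Fin k)) =>
      ∀ h : s e ∈ A ∧ t e ∈ A, π (f ⟨s e, h.1⟩) ≠ f ⟨t e, h.2⟩), edgesIn, ← Finset.prod_const,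
      Finset.prod_filter]
    refine Finset.prod_congr rfl fun e _ => ?_
    split_ifs with h
    · simp only [h, and_self, forall_true_left]
      exact uniformProb_perm_ne _ _
    · simp only [h, IsEmpty.forall_iff]
      exact uniformProb_true
  rw [Finset.sum_congr rfl fun f _ => h2 f]
  simp

/-- Greedy colouring: colour the vertices one by one so that each of them has at most `d` earlier
neighbours. A vertex is stuck only if the colours that its earlier neighbours forbid, which are
independent and uniform, exhaust all `k` colours. -/
theorem uniformProb_not_exists_properOn_le (s t : E → V) (hst : ∀ e, s e ≠ t e) (hk : 0 < k)
    {d : ℕ} (hd : ∀ S : Finset V, S.Nonempty →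
      ∃ v ∈ S, ((edgesIn s t S).filter fun e => s e = v ∨ t e = v).card ≤ d) (S : Finset V) :
    uniformProb (fun σ : E → Equiv.Perm (Fin k) => ¬ ∃ f, ProperOn s t S σ f) ≤
      S.card * (1 - (1 - 1 / k) ^ d) ^ k := by
  classical
  have hk1 : (1 : ℝ) ≤ k := by exact_mod_cast hk
  have hk2 : 1 / (k : ℝ) ≤ 1 := (div_le_one (by linarith)).2 hk1
  have hk3 : 0 < 1 / (k : ℝ) := by positivity
  have hN : (0 : ℝ) < Fintype.card (E → Equiv.Perm (Fin k)) := by exact_mod_cast Fintype.card_pos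
  induction S using Finset.strongInductionOn with
  | _ S ih =>
    rcases S.eq_empty_or_nonempty with rfl | hS
    · rw [uniformProb_false]
      · simp
      · exact fun σ h => h ⟨fun _ => ⟨0, hk⟩, fun e he => by simp at he⟩
    obtain ⟨v, hv, hdeg⟩ := hd S hS
    set D := (edgesIn s t S).filter fun e => s e = v ∨ t e = v with hD
    set δ : ℝ := (1 - (1 - 1 / k) ^ d) ^ k
    have hδ : 0 ≤ δ := pow_nonneg (sub_nonneg.2 (pow_le_one₀ (by linarith) (by linarith))) _
    -- Fix `σ`, which decides the colours of `S \ {v}`, and resample the edges from `v` to `S`.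
    have hin : ∀ σ : E → Equiv.Perm (Fin k),
        uniformProb (fun τ : E → Equiv.Perm (Fin k) =>
          ¬ ∃ f, ProperOn s t S (D.piecewise τ σ) f) ≤
        (if ¬ ∃ f, ProperOn s t (S.erase v) σ f then 1 else 0) + δ := by
      intro σ
      by_cases hc : ∃ f, ProperOn s t (S.erase v) σ f
      · rw [if_neg (not_not.2 hc), zero_add]
        obtain ⟨c, hc⟩ := hc
        let φ : E → Equiv.Perm (Fin k) → Fin k :=
          fun e π => if s e = v then π.symm (c (t e)) else π (c (s e))
        have hφ : ∀ e ∈ D, ∀ j, uniformProb (fun π => φ e π = j) ≤ 1 / (k : ℝ) := by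
          intro e _ j
          by_cases he : s e = v
          · simp only [φ, if_pos he]
            exact (uniformProb_perm_symm_apply _ _).le
          · simp only [φ, if_neg he]
            exact (uniformProb_perm_apply _ _).le
        have hcoupon := uniformProb_forall_exists_le hk1 φ D hφ Finset.univ
        rw [Finset.card_univ, Fintype.card_fin] at hcoupon
        refine le_trans ?_ (hcoupon.trans ?_)
        · refine uniformProb_mono fun τ hτ j _ => ?_
          by_contra hj
          push Not at hj
          refine hτ ⟨Function.update c v j, fun e hs ht => ?_⟩
          by_cases he : e ∈ D
          · rw [Finset.piecewise_eq_of_mem _ _ _ he]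
            have hje := hj e he
            by_cases hsv : s e = v
            · have htv : t e ≠ v := fun h => hst e (hsv.trans h.symm)
              simp only [φ, if_pos hsv] at hje
              rw [hsv, Function.update_self, Function.update_of_ne htv]
              exact fun h => hje (by rw [← h, Equiv.symm_apply_apply])
            · have htv : t e = v :=
                (Finset.mem_filter.1 he).2.resolve_left hsv
              simp only [φ, if_neg hsv] at hje
              rw [htv, Function.update_self, Function.update_of_ne hsv]
              exact hje
          · rw [Finset.piecewise_eq_of_notMem _ _ _ he]
            have hne : ¬ (s e = v ∨ t e = v) := fun h =>
              he (Finset.mem_filter.2 ⟨Finset.mem_filter.2 ⟨Finset.mem_univ _, hs, ht⟩, h⟩)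
            push Not at hne
            rw [Function.update_of_ne hne.1, Function.update_of_ne hne.2]
            exact hc e (Finset.mem_erase.2 ⟨hne.1, hs⟩) (Finset.mem_erase.2 ⟨hne.2, ht⟩)
        · refine pow_le_pow_left₀ (sub_nonneg.2 (pow_le_one₀ (by linarith) (by linarith))) ?_ _
          exact sub_le_sub_left (pow_le_pow_of_le_one (by linarith) (by linarith) hdeg) _
      · rw [if_pos hc]
        exact (uniformProb_le_one _).trans (by linarith)
    rw [uniformProb_resample D]
    calc _ ≤ (∑ σ : E → Equiv.Perm (Fin k),
          ((if ¬ ∃ f, ProperOn s t (S.erase v) σ f then 1 else 0) + δ)) /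
          Fintype.card (E → Equiv.Perm (Fin k)) := by
          gcongr with σ
          exact hin σ
      _ = uniformProb (fun σ : E → Equiv.Perm (Fin k) =>
            ¬ ∃ f, ProperOn s t (S.erase v) σ f) + δ := by
          rw [uniformProb_eq_sum, Finset.sum_add_distrib, Finset.sum_const, Finset.card_univ,
            nsmul_eq_mul, add_div, mul_div_cancel_left₀ _ hN.ne']
          congr!
      _ ≤ (S.erase v).card * δ + δ := by
          gcongr
          exact ih _ (Finset.erase_ssubset hv)
      _ = S.card * δ := by
          rw [← Finset.card_erase_add_one hv]
          push_cast
          ring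

/-- How far the events that two colourings satisfy the constraint of one edge are from being
independent: `(a, b)` and `(a', b')` are the colours that they give to the ends of the edge. -/
theorem uniformProb_perm_ne_ne_le (hk : 2 ≤ k) (a b a' b' : Fin k) :
    uniformProb (fun π : Equiv.Perm (Fin k) => π a ≠ b ∧ π a' ≠ b') ≤
      (1 - 1 / (k : ℝ)) ^ 2 * (1 + 1 / ((k : ℝ) - 1) ^ 3) *
        (if a = a' ∧ b = b' then 1 + 1 / ((k : ℝ) - 1) else 1) := by
  have hk' : (2 : ℝ) ≤ k := by exact_mod_cast hk
  obtain ⟨K, hK⟩ : ∃ K : ℝ, K = k - 1 := ⟨_, rfl⟩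
  have hkK : (k : ℝ) = K + 1 := by linarith
  have hK1 : 1 ≤ K := by linarith
  have hK3 : 1 ≤ 1 + 1 / K ^ 3 := by
    have : 0 < 1 / K ^ 3 := by positivity
    linarith
  have h := uniformProb_not_and_not (fun π : Equiv.Perm (Fin k) => π a = b) (fun π => π a' = b')
  rw [uniformProb_perm_apply, uniformProb_perm_apply] at h
  change uniformProb (fun π : Equiv.Perm (Fin k) => π a ≠ b ∧ π a' ≠ b') = _ at h
  rw [h, ← hK]
  -- If exactly one of the two pairs agrees, the two forbidden events exclude each other.
  have hdisj : (1 : ℝ) - 1 / k - 1 / k ≤ (1 - 1 / (k : ℝ)) ^ 2 * (1 + 1 / K ^ 3) := by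
    have : (1 : ℝ) - 1 / k - 1 / k ≤ (1 - 1 / (k : ℝ)) ^ 2 := by
      nlinarith [sq_nonneg (1 / (k : ℝ))]
    exact this.trans (le_mul_of_one_le_right (sq_nonneg _) hK3)
  by_cases ha : a = a' <;> by_cases hb : b = b'
  · subst ha hb
    simp only [and_self, if_true]
    rw [uniformProb_perm_apply]
    have : (1 - 1 / (k : ℝ)) * (1 + 1 / K) = 1 := by
      rw [hkK]; field_simp; ring
    have h0 : 0 ≤ 1 - 1 / (k : ℝ) := by
      rw [hkK]
      have : 1 / (K + 1) ≤ 1 := (div_le_one (by linarith)).2 (by linarith)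
      linarith
    calc 1 - 1 / (k : ℝ) - 1 / k + 1 / k = (1 - 1 / (k : ℝ)) * 1 := by ring
      _ ≤ (1 - 1 / (k : ℝ)) * (1 + 1 / K ^ 3) := by gcongr
      _ = (1 - 1 / (k : ℝ)) * ((1 - 1 / (k : ℝ)) * (1 + 1 / K)) * (1 + 1 / K ^ 3) := by
          rw [this, mul_one]
      _ = _ := by ring
  · rw [if_neg (fun h => hb h.2), mul_one,
      uniformProb_false (p := fun π : Equiv.Perm (Fin k) => π a = b ∧ π a' = b')]
    · simpa using hdisj
    · rintro π ⟨h1, h2⟩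
      subst ha
      exact hb (h1.symm.trans h2)
  · rw [if_neg (fun h => ha h.1), mul_one,
      uniformProb_false (p := fun π : Equiv.Perm (Fin k) => π a = b ∧ π a' = b')]
    · simpa using hdisj
    · rintro π ⟨h1, h2⟩
      subst hb
      exact ha (π.injective (h1.trans h2.symm))
  · rw [if_neg (fun h => ha h.1), mul_one, uniformProb_perm_apply_two ha hb, ← hK, hkK]
    refine le_of_eq ?_
    field_simp
    ring

/-- The second moment method for the number of proper colourings. A pair of colourings that agree
exactly on `A` is positively correlated only through the factor `1 + 1 / (k - 1) ^ 3` for every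
edge and `1 + 1 / (k - 1)` for the edges inside `A`. Agreement sets with at most `c` vertices are
bounded uniformly by `w`, the others by the probability `(1 / k) ^ |A|` of agreeing on `A`. -/
theorem one_le_uniformProb_exists_properOn_mul [Fintype V] (s t : E → V) (hk : 2 ≤ k) {c : ℕ}
    {w : ℝ} (hw0 : 0 ≤ w)
    (hw : ∀ A : Finset V, A.card ≤ c → (1 + 1 / ((k : ℝ) - 1)) ^ (edgesIn s t A).card ≤ w) :
    1 ≤ uniformProb (fun σ : E → Equiv.Perm (Fin k) => ∃ f, ProperOn s t Finset.univ σ f) *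
      ((1 + 1 / ((k : ℝ) - 1) ^ 3) ^ Fintype.card E *
        (w + ∑ A : Finset V with c < A.card,
          (1 / (k : ℝ)) ^ A.card * (1 + 1 / ((k : ℝ) - 1)) ^ (edgesIn s t A).card)) := by
  classical
  have hk' : (2 : ℝ) ≤ k := by exact_mod_cast hk
  obtain ⟨K, hK⟩ : ∃ K : ℝ, K = k - 1 := ⟨_, rfl⟩
  have hK1 : 1 ≤ K := by linarith
  have hN : (0 : ℝ) < Fintype.card (E → Equiv.Perm (Fin k)) := by exact_mod_cast Fintype.card_pos
  rw [← hK] at hw ⊢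
  set N : ℝ := (Fintype.card (E → Equiv.Perm (Fin k)) : ℝ)
  set n := Fintype.card V
  set m := Fintype.card E
  set W : ℝ := w + ∑ A : Finset V with c < A.card,
          (1 / (k : ℝ)) ^ A.card * (1 + 1 / K) ^ (edgesIn s t A).card with hW
  set P := uniformProb (fun σ : E → Equiv.Perm (Fin k) => ∃ f, ProperOn s t Finset.univ σ f)
    with hP
  have hq : 0 < 1 - 1 / (k : ℝ) := by
    have : 1 / (k : ℝ) ≤ 1 / 2 := one_div_le_one_div_of_le (by norm_num) hk'
    linarith
  let χ : (E → Equiv.Perm (Fin k)) → (V → Fin k) → ℝ :=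
    fun σ f => if ∀ e, σ e (f (s e)) ≠ f (t e) then 1 else 0
  have hfirst : ∑ σ, ∑ f, χ σ f = N * (k ^ n * (1 - 1 / (k : ℝ)) ^ m) := by
    rw [Finset.sum_comm]
    have : ∀ f : V → Fin k, ∑ σ, χ σ f = N * (1 - 1 / (k : ℝ)) ^ m := by
      intro f
      have h := uniformProb_pi (fun e (π : Equiv.Perm (Fin k)) => π (f (s e)) ≠ f (t e))
      simp only [uniformProb_perm_ne, Finset.prod_const, Finset.card_univ] at h
      rw [← h, uniformProb_eq_sum, mul_div_cancel₀ _ hN.ne']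
      simp only [χ]
      congr!
    simp only [this, Finset.sum_const, Finset.card_univ, Fintype.card_fun, Fintype.card_fin,
      nsmul_eq_mul]
    push_cast
    ring
  have hpair : ∀ f g : V → Fin k, ∑ σ, χ σ f * χ σ g ≤
      N * ((1 - 1 / (k : ℝ)) ^ 2 * (1 + 1 / K ^ 3)) ^ m *
        (1 + 1 / K) ^ (edgesIn s t (Finset.univ.filter fun v => f v = g v)).card := by
    intro f g
    have h := uniformProb_pi (fun e (π : Equiv.Perm (Fin k)) =>
      π (f (s e)) ≠ f (t e) ∧ π (g (s e)) ≠ g (t e))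
    have h1 : ∑ σ, χ σ f * χ σ g = N * uniformProb (fun σ : E → Equiv.Perm (Fin k) =>
        ∀ e, σ e (f (s e)) ≠ f (t e) ∧ σ e (g (s e)) ≠ g (t e)) := by
      rw [uniformProb_eq_sum, mul_div_cancel₀ _ hN.ne']
      refine Finset.sum_congr rfl fun σ _ => ?_
      simp only [χ, forall_and, ite_and, ite_mul, one_mul, zero_mul]
    rw [h1, h, mul_assoc]
    refine mul_le_mul_of_nonneg_left ?_ hN.le
    refine (Finset.prod_le_prod (fun e _ => uniformProb_nonneg _)
      (fun e _ => uniformProb_perm_ne_ne_le hk _ _ _ _)).trans (le_of_eq ?_)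
    rw [Finset.prod_mul_distrib, Finset.prod_const, Finset.card_univ, ← hK,
      ← Finset.prod_filter, Finset.prod_const]
    congr 3
    ext e
    simp [edgesIn]
  have hagree : ∀ (f : V → Fin k) (A : Finset V),
      ∑ g : V → Fin k, (if ∀ v ∈ A, f v = g v then (1 : ℝ) else 0) =
        k ^ n * (1 / (k : ℝ)) ^ A.card := by
    intro f A
    have h := uniformProb_pi (fun v (j : Fin k) => v ∈ A → f v = j)
    have h2 : ∀ v, uniformProb (fun j : Fin k => v ∈ A → f v = j) =
        if v ∈ A then 1 / (k : ℝ) else 1 := by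
      intro v
      have : Nonempty (Fin k) := ⟨f v⟩
      split_ifs with hv
      · simp [hv, uniformProb_eq_card, Finset.filter_eq]
      · simp [hv, uniformProb_true]
    simp only [h2] at h
    rw [uniformProb_eq_sum, ← Finset.prod_filter, Finset.prod_const] at h
    have hc : (Fintype.card (V → Fin k) : ℝ) = k ^ n := by
      simp [n]
    rw [hc, div_eq_iff (by positivity), mul_comm] at h
    rw [Finset.filter_mem_eq_inter, Finset.univ_inter] at h
    rw [← h]
    congr!
  have hsecond : ∑ σ, (∑ f, χ σ f) ^ 2 ≤
      N * ((1 - 1 / (k : ℝ)) ^ 2 * (1 + 1 / K ^ 3)) ^ m * (k ^ n * k ^ n * W) := by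
    have hexp : ∑ σ, (∑ f, χ σ f) ^ 2 = ∑ f, ∑ g, ∑ σ, χ σ f * χ σ g := by
      simp only [sq, Finset.sum_mul_sum]
      rw [Finset.sum_comm]
      exact Finset.sum_congr rfl fun f _ => Finset.sum_comm
    rw [hexp]
    refine (Finset.sum_le_sum fun f _ => Finset.sum_le_sum fun g _ => hpair f g).trans ?_
    simp only [← Finset.mul_sum]
    refine mul_le_mul_of_nonneg_left ?_ (by positivity)
    have hterm : ∀ f g : V → Fin k,
        (1 + 1 / K) ^ (edgesIn s t (Finset.univ.filter fun v => f v = g v)).card ≤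
        w + ∑ A : Finset V with c < A.card, (if ∀ v ∈ A, f v = g v then (1 : ℝ) else 0) *
          (1 + 1 / K) ^ (edgesIn s t A).card := by
      intro f g
      set B := Finset.univ.filter fun v => f v = g v with hB
      have hnn : ∀ A ∈ Finset.univ.filter (fun A : Finset V => c < A.card),
          0 ≤ (if ∀ v ∈ A, f v = g v then (1 : ℝ) else 0) *
          (1 + 1 / K) ^ (edgesIn s t A).card := by
        intro A _
        split_ifs <;> positivity
      by_cases hBc : B.card ≤ c
      · exact (hw B hBc).trans (le_add_of_nonneg_right (Finset.sum_nonneg hnn))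
      · have h1 := Finset.single_le_sum hnn
          (Finset.mem_filter.2 ⟨Finset.mem_univ B, not_le.1 hBc⟩)
        rw [if_pos (fun v hv => (Finset.mem_filter.1 hv).2), one_mul] at h1
        exact h1.trans (le_add_of_nonneg_left hw0)
    refine (Finset.sum_le_sum fun f _ => Finset.sum_le_sum fun g _ => hterm f g).trans
      (le_of_eq ?_)
    have : ∀ f : V → Fin k, ∑ g : V → Fin k, (w + ∑ A : Finset V with c < A.card,
        (if ∀ v ∈ A, f v = g v then (1 : ℝ) else 0) * (1 + 1 / K) ^ (edgesIn s t A).card) =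
        k ^ n * W := by
      intro f
      rw [Finset.sum_add_distrib, Finset.sum_comm]
      simp only [← Finset.sum_mul, hagree]
      rw [Finset.sum_const, Finset.card_univ, hW, mul_add, Finset.mul_sum, nsmul_eq_mul]
      simp [n, mul_assoc]
    simp only [this, Finset.sum_const, Finset.card_univ, nsmul_eq_mul]
    simp [n, mul_assoc]
  -- Cauchy–Schwarz on the event that there is a proper colouring.
  have hCS : (∑ σ, ∑ f, χ σ f) ^ 2 ≤ N * P * ∑ σ, (∑ f, χ σ f) ^ 2 := by
    have hsupp : ∑ σ, ∑ f, χ σ f = ∑ σ with ∃ f, ProperOn s t Finset.univ σ f, ∑ f, χ σ f := by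
      symm
      refine Finset.sum_subset (Finset.filter_subset _ _) fun σ _ hσ => ?_
      refine Finset.sum_eq_zero fun f _ => if_neg fun h => hσ ?_
      exact Finset.mem_filter.2 ⟨Finset.mem_univ _, f, fun e _ _ => h e⟩
    have hNP : N * P = (Finset.univ.filter fun σ : E → Equiv.Perm (Fin k) =>
        ∃ f, ProperOn s t Finset.univ σ f).card := by
      rw [hP, uniformProb_eq_card, mul_div_cancel₀ _ hN.ne']
    rw [hsupp, hNP]
    refine sq_sum_le_card_mul_sum_sq.trans ?_
    refine mul_le_mul_of_nonneg_left ?_ (by positivity)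
    exact Finset.sum_le_sum_of_subset_of_nonneg (Finset.filter_subset _ _)
      (fun _ _ _ => sq_nonneg _)
  rw [hfirst] at hCS
  have hP0 : 0 ≤ P := uniformProb_nonneg _
  have hfin := hCS.trans (mul_le_mul_of_nonneg_left hsecond (by positivity))
  have hX : 0 < (N * (k ^ n * (1 - 1 / (k : ℝ)) ^ m)) ^ 2 := by positivity
  refine le_of_mul_le_mul_left ?_ hX
  rw [mul_one]
  refine hfin.trans (le_of_eq ?_)
  rw [mul_pow _ (1 + 1 / K ^ 3), ← pow_mul, mul_comm 2 m, pow_mul]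
  ring

end Oriented

/-! ### Random covers of a graph and its maximum density -/

section Graph

variable {V : Type u} [LinearOrder V] {G : SimpleGraph V} {k : ℕ}

/-- The smaller end of an edge. -/
def edgeSource (e : G.edgeSet) : V := e.1.inf

/-- The larger end of an edge. -/
def edgeTarget (e : G.edgeSet) : V := e.1.sup

theorem mk_edgeSource_edgeTarget (e : G.edgeSet) : s(edgeSource e, edgeTarget e) = e.1 := by
  obtain ⟨e, he⟩ := e
  induction e using Sym2.ind with
  | _ a b =>
    rcases le_total a b with h | h <;> simp [edgeSource, edgeTarget, h, Sym2.eq_swap]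

theorem adj_edgeSource_edgeTarget (e : G.edgeSet) : G.Adj (edgeSource e) (edgeTarget e) := by
  have := e.2
  rwa [← mk_edgeSource_edgeTarget e] at this

theorem edgeSource_lt_edgeTarget (e : G.edgeSet) : edgeSource e < edgeTarget e := by
  exact lt_of_le_of_ne e.1.inf_le_sup (adj_edgeSource_edgeTarget e).ne

theorem edgeSource_mk {a b : V} (h : G.Adj a b) (hlt : a < b) :
    edgeSource (⟨s(a, b), h⟩ : G.edgeSet) = a :=
  inf_eq_left.2 hlt.le

theorem edgeTarget_mk {a b : V} (h : G.Adj a b) (hlt : a < b) :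
    edgeTarget (⟨s(a, b), h⟩ : G.edgeSet) = b :=
  sup_eq_right.2 hlt.le

/-- An independent transversal of the cover is the graph of a proper colouring. -/
theorem permCover_colorable_iff [Fintype V] (σ : G.edgeSet → Equiv.Perm (Fin k)) :
    (permCover G σ).Colorable ↔
      ∃ f, ProperOn edgeSource edgeTarget (Finset.univ : Finset V) σ f := by
  constructor
  · rintro ⟨T, hT, hI⟩
    choose x hx _ using hT
    have hx1 : ∀ v, (x v).1 = v := fun v => (hx v).2
    refine ⟨fun v => (x v).2, fun e _ _ h => ?_⟩
    have hadj : G.Adj (x (edgeSource e)).1 (x (edgeTarget e)).1 := by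
      rw [hx1, hx1]
      exact adj_edgeSource_edgeTarget e
    have hlt : (x (edgeSource e)).1 < (x (edgeTarget e)).1 := by
      rw [hx1, hx1]
      exact edgeSource_lt_edgeTarget e
    refine hI (hx (edgeSource e)).1 (hx (edgeTarget e)).1 (fun h' => hlt.ne (congrArg Prod.fst h'))
      (Or.inl ⟨hadj, hlt, ?_⟩)
    have he : (⟨s((x (edgeSource e)).1, (x (edgeTarget e)).1), hadj⟩ : G.edgeSet) = e := by
      refine Subtype.ext ?_
      simp only [hx1]
      exact mk_edgeSource_edgeTarget e
    rw [he]
    exact h.symm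
  · rintro ⟨f, hf⟩
    have key : ∀ a b : V, ∀ h : G.Adj a b, a < b → f b ≠ σ ⟨s(a, b), h⟩ (f a) := by
      intro a b h hlt heq
      refine hf ⟨s(a, b), h⟩ (Finset.mem_univ _) (Finset.mem_univ _) ?_
      rw [edgeSource_mk h hlt, edgeTarget_mk h hlt]
      exact heq.symm
    refine ⟨{x | x.2 = f x.1}, fun v => ⟨(v, f v), ⟨rfl, rfl⟩, ?_⟩, ?_⟩
    · rintro ⟨a, i⟩ ⟨h1, h2⟩
      obtain rfl : a = v := h2
      exact Prod.ext rfl h1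
    · rintro ⟨a, i⟩ ha ⟨b, j⟩ hb _ h
      obtain rfl : i = f a := ha
      obtain rfl : j = f b := hb
      rcases h with ⟨h, hlt, heq⟩ | ⟨h, hlt, heq⟩
      · exact key _ _ h hlt heq
      · exact key _ _ h hlt heq

theorem card_edgesIn_le_sq [Fintype G.edgeSet] (A : Finset V) :
    (edgesIn edgeSource edgeTarget A : Finset G.edgeSet).card ≤ A.card ^ 2 := by
  rw [sq, ← Finset.card_product]
  refine Finset.card_le_card_of_injOn (fun e => (edgeSource e, edgeTarget e)) ?_ ?_
  · intro e he
    exact Finset.mem_coe.2 (Finset.mem_product.2 (Finset.mem_filter.1 he).2)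
  · intro e _ e' _ h
    obtain ⟨h1, h2⟩ := Prod.ext_iff.1 h
    refine Subtype.ext ?_
    rw [← mk_edgeSource_edgeTarget e, ← mk_edgeSource_edgeTarget e']
    exact congrArg₂ _ h1 h2

variable [Fintype V] [Fintype G.edgeSet]

theorem dpColorableProb_eq [DecidableEq G.edgeSet] :
    dpColorableProb G k = uniformProb fun σ : G.edgeSet → Equiv.Perm (Fin k) =>
      ∃ f, ProperOn edgeSource edgeTarget (Finset.univ : Finset V) σ f := by
  rw [uniformProb_eq_natCard, dpColorableProb]
  simp only [permCover_colorable_iff]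

omit [Fintype G.edgeSet] in
theorem dpColorableProb_le_one : dpColorableProb G k ≤ 1 := by
  classical
  rw [dpColorableProb_eq]
  exact uniformProb_le_one _

omit [Fintype G.edgeSet] in
theorem dpColorableProb_nonneg : 0 ≤ dpColorableProb G k := by
  classical
  rw [dpColorableProb_eq]
  exact uniformProb_nonneg _

theorem card_edgesIn_le_mul (A : Finset V) :
    ((edgesIn edgeSource edgeTarget A : Finset G.edgeSet).card : ℝ) ≤ G.maxDensity * A.card := by
  rcases A.eq_empty_or_nonempty with rfl | ⟨v, hv⟩
  · simp [edgesIn]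
  have : Nonempty V := ⟨v⟩
  let G' : G.Subgraph := (⊤ : G.Subgraph).induce (A : Set V)
  have h1 := G.isGreatest_maxDensity.2 ⟨G', ⟨v, hv⟩, rfl⟩
  have h2 : (edgesIn edgeSource edgeTarget A : Finset G.edgeSet).card ≤ G'.edgeSet.ncard := by
    rw [← Finset.card_map (Function.Embedding.subtype _), ← Set.ncard_coe_finset]
    refine Set.ncard_le_ncard ?_ (Set.toFinite _)
    intro e he
    obtain ⟨e, heA, rfl⟩ := Finset.mem_map.1 (Finset.mem_coe.1 he)
    obtain ⟨hs, ht⟩ := (Finset.mem_filter.1 heA).2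
    rw [Function.Embedding.subtype_apply, ← mk_edgeSource_edgeTarget e]
    exact ⟨hs, ht, adj_edgeSource_edgeTarget e⟩
  have h3 : G'.verts.ncard = A.card := Set.ncard_coe_finset A
  have hA : (0 : ℝ) < A.card := by exact_mod_cast Finset.card_pos.2 ⟨v, hv⟩
  rw [SimpleGraph.Subgraph.density, h3, div_le_iff₀ hA] at h1
  exact le_trans (by exact_mod_cast h2) h1

/-- A densest subgraph, given by its vertex set. -/
theorem exists_mul_le_card_edgesIn [Nonempty V] : ∃ A : Finset V, A.Nonempty ∧
    G.maxDensity * A.card ≤ (edgesIn edgeSource edgeTarget A : Finset G.edgeSet).card := by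
  classical
  obtain ⟨G', hne, hG'⟩ := G.isGreatest_maxDensity.1
  refine ⟨G'.verts.toFinset, by simpa using hne, ?_⟩
  have h2 : G'.edgeSet.ncard ≤
      (edgesIn edgeSource edgeTarget G'.verts.toFinset : Finset G.edgeSet).card := by
    rw [← Finset.card_map (Function.Embedding.subtype _), ← Set.ncard_coe_finset]
    refine Set.ncard_le_ncard ?_ (Set.toFinite _)
    intro e he
    refine Finset.mem_coe.2 (Finset.mem_map.2
      ⟨⟨e, G'.edgeSet_subset he⟩, Finset.mem_filter.2 ⟨Finset.mem_univ _, ?_⟩, rfl⟩)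
    have he' : s(_, _) = e := mk_edgeSource_edgeTarget ⟨e, G'.edgeSet_subset he⟩
    have he : G'.Adj _ _ := SimpleGraph.Subgraph.mem_edgeSet.1 (by rwa [he'])
    simp only [Set.mem_toFinset]
    exact ⟨he.fst_mem, he.snd_mem⟩
  have h3 : (0 : ℝ) < G'.verts.ncard := by exact_mod_cast (Set.ncard_pos (Set.toFinite _)).2 hne
  rw [hG', SimpleGraph.Subgraph.density, ← Set.ncard_eq_toFinset_card', div_mul_cancel₀ _ h3.ne']
  exact_mod_cast h2

/-- Every set of vertices spans a vertex of degree at most twice the maximum density. -/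
theorem exists_card_filter_edgesIn_le (S : Finset V) (hS : S.Nonempty) :
    ∃ v ∈ S, ((edgesIn edgeSource edgeTarget S : Finset G.edgeSet).filter
      fun e => edgeSource e = v ∨ edgeTarget e = v).card ≤ ⌊2 * G.maxDensity⌋₊ := by
  by_contra! h
  have h1 : ∑ v ∈ S, ((edgesIn edgeSource edgeTarget S : Finset G.edgeSet).filter
      fun e => edgeSource e = v ∨ edgeTarget e = v).card ≤
      2 * (edgesIn edgeSource edgeTarget S : Finset G.edgeSet).card := by
    refine (Finset.sum_card_bipartiteAbove_eq_sum_card_bipartiteBelow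
      (fun v (e : G.edgeSet) => edgeSource e = v ∨ edgeTarget e = v)).trans_le ?_
    rw [mul_comm, ← smul_eq_mul]
    refine Finset.sum_le_card_nsmul _ _ _ fun e _ => ?_
    refine (Finset.card_le_card (t := {edgeSource e, edgeTarget e}) fun v hv => ?_).trans
      Finset.card_le_two
    rcases (Finset.mem_filter.1 hv).2 with rfl | rfl <;> simp
  have h2 : ∀ v ∈ S, 2 * G.maxDensity < (((edgesIn edgeSource edgeTarget S :
      Finset G.edgeSet).filter fun e => edgeSource e = v ∨ edgeTarget e = v).card : ℝ) :=
    fun v hv => Nat.lt_of_floor_lt (h v hv)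
  have h3 := Finset.sum_lt_sum_of_nonempty hS h2
  rw [Finset.sum_const, nsmul_eq_mul, ← Nat.cast_sum] at h3
  have h4 : ((∑ v ∈ S, ((edgesIn edgeSource edgeTarget S : Finset G.edgeSet).filter
      fun e => edgeSource e = v ∨ edgeTarget e = v).card : ℕ) : ℝ) ≤
      2 * (edgesIn edgeSource edgeTarget S : Finset G.edgeSet).card := by exact_mod_cast h1
  have := card_edgesIn_le_mul (G := G) S
  linarith

end Graph

/-! ### Explicit bounds for one graph, in terms of `L = log ρ` -/

section Bounds

variable {V : Type u} [LinearOrder V] [Fintype V] {G : SimpleGraph V} {k : ℕ} {L : ℝ}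

/-- The first moment bound at a densest subgraph, on whose vertex set `A` it reads
`(k * exp (-ρ / k)) ^ |A|`. -/
theorem dpColorableProb_le_exp [Nonempty V] {ε : ℝ} (h0 : 0 < ε) (h1 : ε < 1) (hL : 1 ≤ L)
    (hρ : G.maxDensity = Real.exp L) (hk : (k : ℝ) ≤ (1 - ε) * (Real.exp L / L)) :
    dpColorableProb G k ≤ Real.exp (-(ε / (1 - ε)) * L) := by
  classical
  obtain ⟨A, hA, hdens⟩ := exists_mul_le_card_edgesIn (G := G)
  have hA1 : A.card ≠ 0 := (Finset.card_pos.2 hA).ne'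
  have hle : dpColorableProb G k ≤ (k : ℝ) ^ A.card *
      (1 - 1 / k) ^ (edgesIn edgeSource edgeTarget A : Finset G.edgeSet).card := by
    rw [dpColorableProb_eq]
    exact (uniformProb_mono fun σ ⟨f, hf⟩ =>
      ⟨f, fun e _ _ => hf e (Finset.mem_univ _) (Finset.mem_univ _)⟩).trans
      (uniformProb_exists_properOn_le edgeSource edgeTarget A)
  refine hle.trans ?_
  rcases Nat.eq_zero_or_pos k with rfl | hk0
  · simp only [Nat.cast_zero, zero_pow hA1, zero_mul]
    positivity
  have hk1 : (1 : ℝ) ≤ k := by exact_mod_cast hk0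
  have hkp : (0 : ℝ) < k := by linarith
  have h1ε : 0 < 1 - ε := by linarith
  have hLp : 0 < L := by linarith
  have hkρ : (k : ℝ) ≤ Real.exp L := by
    refine hk.trans ?_
    calc (1 - ε) * (Real.exp L / L) ≤ 1 * (Real.exp L / 1) := by
          gcongr
          linarith
      _ = Real.exp L := by ring
  have hkL : L / (1 - ε) ≤ Real.exp L / k := by
    rw [div_le_div_iff₀ h1ε hkp]
    have := mul_le_mul_of_nonneg_right hk hLp.le
    calc L * k = k * L := mul_comm _ _
      _ ≤ (1 - ε) * (Real.exp L / L) * L := this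
      _ = Real.exp L * (1 - ε) := by field_simp
  have hbase : (k : ℝ) * Real.exp (-(Real.exp L / k)) ≤ Real.exp (-(ε / (1 - ε)) * L) := by
    calc (k : ℝ) * Real.exp (-(Real.exp L / k)) ≤ Real.exp L * Real.exp (-(L / (1 - ε))) := by
          gcongr
      _ = Real.exp (-(ε / (1 - ε)) * L) := by
          rw [← Real.exp_add]
          congr 1
          field_simp
          ring
  have hpow : (1 - 1 / (k : ℝ)) ^ (edgesIn edgeSource edgeTarget A : Finset G.edgeSet).card ≤
      Real.exp (-(Real.exp L / k)) ^ A.card := by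
    have hk2 : 0 ≤ 1 - 1 / (k : ℝ) := sub_nonneg.2 ((div_le_one hkp).2 hk1)
    refine (pow_le_pow_left₀ hk2 (Real.one_sub_le_exp_neg (1 / (k : ℝ))) _).trans ?_
    rw [← Real.exp_nat_mul, ← Real.exp_nat_mul]
    refine Real.exp_le_exp.2 ?_
    rw [hρ] at hdens
    rw [mul_neg, mul_neg, neg_le_neg_iff, mul_one_div, mul_div_assoc', mul_comm]
    gcongr
  calc _ ≤ (k : ℝ) ^ A.card * Real.exp (-(Real.exp L / k)) ^ A.card := by gcongr
    _ = ((k : ℝ) * Real.exp (-(Real.exp L / k))) ^ A.card := (mul_pow _ _ _).symm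
    _ ≤ Real.exp (-(ε / (1 - ε)) * L) ^ A.card := by gcongr
    _ ≤ Real.exp (-(ε / (1 - ε)) * L) := by
        refine pow_le_of_le_one (Real.exp_pos _).le (Real.exp_le_one_iff.2 ?_) hA1
        have : 0 < ε / (1 - ε) * L := by positivity
        linarith

/-- The greedy bound. The constant `9` is chosen so that a vertex with `2ρ` earlier neighbours
keeps about `k * exp (-2ρ / k) ≥ ρ ^ (1 / 2)` colours on average. -/
theorem one_sub_exp_le_dpColorableProb (hL : 1 ≤ L) (hL4 : L ≤ Real.exp (L / 4))
    (hρ : G.maxDensity = Real.exp L) (hV : 0 < Fintype.card V)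
    (hn : Real.log (Fintype.card V) ≤ Real.exp (L / 4))
    (hk : 9 * (Real.exp L / L) ≤ k) :
    1 - Real.exp (Real.exp (L / 4) - Real.exp (L / 2)) ≤ dpColorableProb G k := by
  classical
  have hLp : 0 < L := by linarith
  have hx : Real.exp (3 * L / 4) ≤ Real.exp L / L := by
    rw [le_div_iff₀ hLp]
    calc Real.exp (3 * L / 4) * L ≤ Real.exp (3 * L / 4) * Real.exp (L / 4) := by gcongr
      _ = Real.exp L := by rw [← Real.exp_add]; congr 1; ring
  have hx1 : 1 ≤ Real.exp (3 * L / 4) := Real.one_le_exp (by linarith)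
  have hK : 8 * (Real.exp L / L) ≤ k - 1 := by linarith
  have hKp : (0 : ℝ) < k - 1 := by linarith
  have hkp : (0 : ℝ) < k := by linarith
  have hk0 : 0 < k := by exact_mod_cast hkp
  set d := ⌊2 * G.maxDensity⌋₊
  have hd : (d : ℝ) ≤ 2 * Real.exp L := by
    rw [← hρ]
    exact Nat.floor_le (by rw [hρ]; positivity)
  have hgreedy := uniformProb_not_exists_properOn_le (E := G.edgeSet) edgeSource edgeTarget
    (fun e => (edgeSource_lt_edgeTarget e).ne) hk0 exists_card_filter_edgesIn_le Finset.univ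
  rw [uniformProb_not, ← dpColorableProb_eq, Finset.card_univ] at hgreedy
  have hq0 : 0 < 1 - 1 / (k : ℝ) := by
    rw [sub_pos, div_lt_one hkp]
    linarith
  have hq : Real.exp (-(1 / ((k : ℝ) - 1))) ≤ 1 - 1 / k := by
    rw [Real.exp_neg]
    refine inv_le_of_inv_le₀ hq0 ?_
    have : (1 - 1 / (k : ℝ))⁻¹ = 1 / ((k : ℝ) - 1) + 1 := by
      field_simp
      ring
    rw [this]
    exact Real.add_one_le_exp _
  have hqd : Real.exp (-(L / 4)) ≤ (1 - 1 / (k : ℝ)) ^ d := by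
    refine le_trans ?_ (pow_le_pow_left₀ (Real.exp_pos _).le hq d)
    rw [← Real.exp_nat_mul]
    refine Real.exp_le_exp.2 ?_
    rw [mul_neg, neg_le_neg_iff, mul_one_div, div_le_iff₀ hKp]
    have := mul_le_mul_of_nonneg_left hK (show 0 ≤ L / 4 by linarith)
    have h2 : L / 4 * (8 * (Real.exp L / L)) = 2 * Real.exp L := by
      field_simp
      norm_num
    linarith
  have hq1 : (1 - 1 / (k : ℝ)) ^ d ≤ 1 := pow_le_one₀ hq0.le (by
    have : 0 < 1 / (k : ℝ) := by positivity
    linarith)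
  have hfail : (1 - (1 - 1 / (k : ℝ)) ^ d) ^ k ≤ Real.exp (-Real.exp (L / 2)) := by
    refine (pow_le_pow_left₀ (sub_nonneg.2 hq1) (Real.one_sub_le_exp_neg _) _).trans ?_
    rw [← Real.exp_nat_mul]
    refine Real.exp_le_exp.2 ?_
    rw [mul_neg, neg_le_neg_iff]
    calc Real.exp (L / 2) = Real.exp (3 * L / 4) * Real.exp (-(L / 4)) := by
          rw [← Real.exp_add]; congr 1; ring
      _ ≤ k * (1 - 1 / (k : ℝ)) ^ d := by
          gcongr
          linarith
  have hnexp : (Fintype.card V : ℝ) ≤ Real.exp (Real.exp (L / 4)) :=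
    (Real.log_le_iff_le_exp (by exact_mod_cast hV)).1 hn
  have : (Fintype.card V : ℝ) * (1 - (1 - 1 / (k : ℝ)) ^ d) ^ k ≤
      Real.exp (Real.exp (L / 4) - Real.exp (L / 2)) := by
    rw [sub_eq_add_neg (Real.exp (L / 4)), Real.exp_add]
    refine mul_le_mul hnexp hfail (pow_nonneg (sub_nonneg.2 hq1) _) (Real.exp_pos _).le
  linarith

theorem one_add_le_exp (x : ℝ) : 1 + x ≤ Real.exp x := by
  rw [add_comm]
  exact Real.add_one_le_exp x

theorem choose_le_exp_mul_div_pow (n : ℕ) {a : ℕ} (ha : 0 < a) :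
    (n.choose a : ℝ) ≤ (Real.exp 1 * n / a) ^ a := by
  have ha' : (0 : ℝ) < a := by exact_mod_cast ha
  have h1 : (n.choose a : ℝ) ≤ n ^ a / a.factorial := Nat.choose_le_pow_div a n
  have h2 := Real.pow_div_factorial_le_exp (a : ℝ) ha'.le a
  rw [div_le_iff₀ (by positivity)] at h2
  refine h1.trans ?_
  rw [div_le_iff₀ (by positivity), div_pow, mul_pow, ← Real.exp_nat_mul, mul_one]
  rw [div_mul_eq_mul_div, le_div_iff₀ (by positivity)]
  nlinarith [pow_nonneg (Nat.cast_nonneg (α := ℝ) n) a]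

/-- The ratio of the geometric series that bounds the contribution of large agreement sets to the
second moment. -/
noncomputable def overlapRatio (θ L : ℝ) : ℝ :=
  Real.exp 1 * (Real.exp 1 + 1) * (Real.exp (-(θ / 2) * L) * L ^ 2)

/-- The bound on the second moment of the number of colourings, divided by the square of the
first. -/
noncomputable def secondMomentRatio (θ L : ℝ) : ℝ :=
  Real.exp (Real.exp ((θ / 2 - 1) * L) * L ^ 3) *
    (Real.exp (Real.exp (-(1 / 3) * L) * L) + overlapRatio θ L / (1 - overlapRatio θ L))

/-- The ratio bound for agreement sets of more than `ρ ^ (1 / 3)` vertices. Such a set of `a`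
vertices spans at most `min ρ a * a` edges; the bound `a` is used for `a ≤ k - 1` and the bound `ρ`
otherwise. -/
theorem mul_exp_min_le_overlapRatio {θ n K a : ℝ} (hθ : 0 < θ) (hθ3 : θ ≤ 1 / 3) (hL : 1 ≤ L)
    (hK : Real.exp L ≤ (1 - θ) * L * K) (hK1 : 1 ≤ K)
    (hn : n ≤ Real.exp ((1 + θ / 2) * L)) (ha : Real.exp (1 / 3 * L) ≤ a) :
    Real.exp 1 * n / a * (Real.exp (min (Real.exp L) a / K) / K) ≤ overlapRatio θ L := by
  have hLp : 0 < L := by linarith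
  have hKp : 0 < K := by linarith
  have hap : 0 < a := (Real.exp_pos _).trans_le ha
  have hKL : 1 / K ≤ L * Real.exp (-L) := by
    rw [Real.exp_neg, ← div_eq_mul_inv, div_le_div_iff₀ hKp (Real.exp_pos _), one_mul]
    nlinarith [mul_pos hLp hKp]
  have hnK : n * (1 / K) ≤ Real.exp (θ / 2 * L) * L := by
    calc n * (1 / K) ≤ Real.exp ((1 + θ / 2) * L) * (L * Real.exp (-L)) := by gcongr
      _ = (Real.exp ((1 + θ / 2) * L) * Real.exp (-L)) * L := by ring
      _ = Real.exp (θ / 2 * L) * L := by rw [← Real.exp_add]; congr 2; ring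
  have hX : 0 < Real.exp (-(θ / 2) * L) := Real.exp_pos _
  have he : 0 < Real.exp 1 := Real.exp_pos _
  rcases le_total a K with haK | haK
  · have h1 : Real.exp (min (Real.exp L) a / K) ≤ Real.exp 1 :=
      Real.exp_le_exp.2 ((div_le_one hKp).2 ((min_le_right _ _).trans haK))
    have h2 : 1 / a ≤ Real.exp (-θ * L) := by
      rw [one_div_le hap (Real.exp_pos _), one_div, ← Real.exp_neg]
      refine le_trans (Real.exp_le_exp.2 ?_) ha
      nlinarith
    calc _ = Real.exp 1 * (n * (1 / K)) * (1 / a) * Real.exp (min (Real.exp L) a / K) := by ring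
      _ ≤ Real.exp 1 * (Real.exp (θ / 2 * L) * L) * Real.exp (-θ * L) * Real.exp 1 := by gcongr
      _ = Real.exp 1 * Real.exp 1 * ((Real.exp (θ / 2 * L) * Real.exp (-θ * L)) * L) := by ring
      _ = Real.exp 1 * Real.exp 1 * (Real.exp (-(θ / 2) * L) * L) := by
          rw [← Real.exp_add (θ / 2 * L)]; congr 3; ring
      _ ≤ overlapRatio θ L := by
          unfold overlapRatio
          gcongr
          · linarith
          · nlinarith
  · have h1 : Real.exp (min (Real.exp L) a / K) ≤ Real.exp ((1 - θ) * L) := by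
      refine Real.exp_le_exp.2 ((div_le_iff₀ hKp).2 ((min_le_left _ _).trans hK))
    have h2 : 1 / a ≤ L * Real.exp (-L) := (one_div_le_one_div_of_le hKp haK).trans hKL
    calc _ = Real.exp 1 * (n * (1 / K)) * (1 / a) * Real.exp (min (Real.exp L) a / K) := by ring
      _ ≤ Real.exp 1 * (Real.exp (θ / 2 * L) * L) * (L * Real.exp (-L)) *
          Real.exp ((1 - θ) * L) := by gcongr
      _ = Real.exp 1 * (Real.exp (θ / 2 * L) * Real.exp (-L) * Real.exp ((1 - θ) * L) * L ^ 2) := by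
          ring
      _ = Real.exp 1 * (Real.exp (-(θ / 2) * L) * L ^ 2) := by
          rw [← Real.exp_add, ← Real.exp_add]; congr 3; ring_nf
      _ ≤ overlapRatio θ L := by
          unfold overlapRatio
          gcongr
          nlinarith

theorem one_le_dpColorableProb_mul_secondMomentRatio {θ : ℝ} (hθ : 0 < θ) (hθ3 : θ ≤ 1 / 3)
    (hL : 1 ≤ L) (hρ : G.maxDensity = Real.exp L) (hK : Real.exp L ≤ (1 - θ) * L * (k - 1))
    (hk : 2 ≤ k) (hn : (Fintype.card V : ℝ) ≤ Real.exp ((1 + θ / 2) * L))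
    (hq : overlapRatio θ L < 1) :
    1 ≤ dpColorableProb G k * secondMomentRatio θ L := by
  classical
  have hLp : 0 < L := by linarith
  obtain ⟨K, hKdef⟩ : ∃ K : ℝ, K = k - 1 := ⟨_, rfl⟩
  have hk' : (2 : ℝ) ≤ k := by exact_mod_cast hk
  have hK1 : 1 ≤ K := by linarith
  have hKp : 0 < K := by linarith
  have hq0 : 0 ≤ overlapRatio θ L := by unfold overlapRatio; positivity
  have hKL : 1 / K ≤ L * Real.exp (-L) := by
    rw [← hKdef] at hK
    rw [Real.exp_neg, ← div_eq_mul_inv, div_le_div_iff₀ hKp (Real.exp_pos _), one_mul]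
    nlinarith [mul_pos hLp hKp]
  -- The number `(1 + 1 / K) ^ e` is bounded through `1 + x ≤ exp x` throughout.
  have hpow : ∀ (e : ℕ) (b : ℝ), (e : ℝ) ≤ b → (1 + 1 / K) ^ e ≤ Real.exp (b * (1 / K)) := by
    intro e b hb
    refine (pow_le_pow_left₀ (by positivity) (one_add_le_exp (1 / K)) e).trans ?_
    rw [← Real.exp_nat_mul]
    exact Real.exp_le_exp.2 (by gcongr)
  have hsmall : ∀ A : Finset V, A.card ≤ ⌊Real.exp (1 / 3 * L)⌋₊ →
      (1 + 1 / ((k : ℝ) - 1)) ^ (edgesIn edgeSource edgeTarget A : Finset G.edgeSet).card ≤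
        Real.exp (Real.exp (-(1 / 3) * L) * L) := by
    intro A hA
    rw [← hKdef]
    have hA' : (A.card : ℝ) ≤ Real.exp (1 / 3 * L) :=
      (Nat.le_floor_iff (Real.exp_pos _).le).1 hA
    refine (hpow _ ((A.card : ℝ) ^ 2) (by exact_mod_cast card_edgesIn_le_sq A)).trans ?_
    refine Real.exp_le_exp.2 ?_
    calc (A.card : ℝ) ^ 2 * (1 / K) ≤ Real.exp (1 / 3 * L) ^ 2 * (L * Real.exp (-L)) := by
          gcongr
      _ = (Real.exp ((2 : ℕ) * (1 / 3 * L)) * Real.exp (-L)) * L := by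
          rw [Real.exp_nat_mul]; ring
      _ = Real.exp (-(1 / 3) * L) * L := by
          rw [← Real.exp_add]; congr 2; push_cast; ring
  have hmain := one_le_uniformProb_exists_properOn_mul (E := G.edgeSet) edgeSource edgeTarget hk
    (Real.exp_pos _).le hsmall
  rw [← dpColorableProb_eq, ← hKdef] at hmain
  refine hmain.trans (mul_le_mul_of_nonneg_left ?_ dpColorableProb_nonneg)
  have hedges : (Fintype.card G.edgeSet : ℝ) ≤ Real.exp L * Fintype.card V := by
    have h := card_edgesIn_le_mul (G := G) Finset.univ
    rw [hρ, Finset.card_univ] at h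
    simpa [edgesIn] using h
  have hfac : (1 + 1 / K ^ 3) ^ Fintype.card G.edgeSet ≤
      Real.exp (Real.exp ((θ / 2 - 1) * L) * L ^ 3) := by
    refine (pow_le_pow_left₀ (by positivity) (one_add_le_exp (1 / K ^ 3)) _).trans ?_
    rw [← Real.exp_nat_mul]
    refine Real.exp_le_exp.2 ?_
    calc (Fintype.card G.edgeSet : ℝ) * (1 / K ^ 3) =
          (Fintype.card G.edgeSet : ℝ) * (1 / K) ^ 3 := by rw [div_pow, one_pow]
      _ ≤ (Real.exp L * Real.exp ((1 + θ / 2) * L)) * (L * Real.exp (-L)) ^ 3 := by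
          gcongr
          exact hedges.trans (by gcongr)
      _ = Real.exp L * Real.exp ((1 + θ / 2) * L) * Real.exp ((3 : ℕ) * -L) * L ^ 3 := by
          rw [mul_pow, Real.exp_nat_mul]; ring
      _ = Real.exp ((θ / 2 - 1) * L) * L ^ 3 := by
          rw [← Real.exp_add, ← Real.exp_add]; congr 2; push_cast; ring
  set n := Fintype.card V with hndef
  set c := ⌊Real.exp (1 / 3 * L)⌋₊ with hc
  set q := overlapRatio θ L with hqdef
  have hlarge : ∑ A : Finset V with c < A.card, (1 / (k : ℝ)) ^ A.card *
      (1 + 1 / K) ^ (edgesIn edgeSource edgeTarget A : Finset G.edgeSet).card ≤ q / (1 - q) := by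
    let B : ℕ → ℝ := fun a => Real.exp (min (Real.exp L) a / K) / K
    have hterm : ∀ A : Finset V, (1 / (k : ℝ)) ^ A.card *
        (1 + 1 / K) ^ (edgesIn edgeSource edgeTarget A : Finset G.edgeSet).card ≤
        B A.card ^ A.card := by
      intro A
      have h1 : ((edgesIn edgeSource edgeTarget A : Finset G.edgeSet).card : ℝ) ≤
          A.card * min (Real.exp L) A.card := by
        have h2 := card_edgesIn_le_mul (G := G) A
        have h3 : ((edgesIn edgeSource edgeTarget A : Finset G.edgeSet).card : ℝ) ≤
          (A.card : ℝ) ^ 2 := by exact_mod_cast card_edgesIn_le_sq A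
        rw [hρ] at h2
        rcases min_choice (Real.exp L) (A.card : ℝ) with h | h <;> rw [h]
        · linarith
        · rwa [← sq]
      have h2 : 1 / (k : ℝ) ≤ 1 / K := one_div_le_one_div_of_le hKp (by linarith)
      calc _ ≤ (1 / K) ^ A.card *
            Real.exp (A.card * min (Real.exp L) A.card * (1 / K)) := by
            gcongr
            exact hpow _ _ h1
        _ = B A.card ^ A.card := by
            simp only [B]
            rw [div_pow (Real.exp _), ← Real.exp_nat_mul, div_pow 1, one_pow]
            rw [show (A.card : ℝ) * (min (Real.exp L) A.card / K) =
              A.card * min (Real.exp L) A.card * (1 / K) by ring]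
            ring
    calc _ ≤ ∑ A : Finset V with c < A.card, B A.card ^ A.card :=
          Finset.sum_le_sum fun A _ => hterm A
      _ = ∑ A ∈ (Finset.univ : Finset V).powerset, if c < A.card then B A.card ^ A.card else 0 := by
          rw [Finset.powerset_univ, Finset.sum_filter]
      _ = ∑ a ∈ Finset.range (n + 1), n.choose a • (if c < a then B a ^ a else 0) := by
          rw [Finset.sum_powerset_apply_card (fun a => if c < a then B a ^ a else 0)]
          rfl
      _ ≤ ∑ a ∈ Finset.range (n + 1), if 0 < a then q ^ a else 0 := by
          refine Finset.sum_le_sum fun a _ => ?_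
          by_cases hca : c < a
          · have ha0 : 0 < a := by omega
            rw [if_pos hca, if_pos ha0, nsmul_eq_mul]
            have hB : 0 ≤ B a := by simp only [B]; positivity
            calc (n.choose a : ℝ) * B a ^ a ≤ (Real.exp 1 * n / a) ^ a * B a ^ a := by
                  gcongr
                  exact choose_le_exp_mul_div_pow n ha0
              _ = (Real.exp 1 * n / a * B a) ^ a := (mul_pow _ _ _).symm
              _ ≤ q ^ a := by
                  gcongr
                  refine mul_exp_min_le_overlapRatio hθ hθ3 hL ?_ hK1 hn
                    (Nat.lt_of_floor_lt hca).le
                  rwa [hKdef]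
          · rw [if_neg hca, smul_zero]
            split_ifs <;> positivity
      _ = q * ∑ a ∈ Finset.range n, q ^ a := by
          rw [Finset.sum_range_succ', Finset.mul_sum]
          simp [pow_succ, mul_comm]
      _ ≤ q * (1 - q)⁻¹ := by
          gcongr
          rw [← tsum_geometric_of_lt_one hq0 hq]
          exact (summable_geometric_of_lt_one hq0 hq).sum_le_tsum _ fun _ _ => by positivity
      _ = q / (1 - q) := (div_eq_mul_inv _ _).symm
  unfold secondMomentRatio
  gcongr

end Bounds

/-! ### Limits in `L = log ρ` -/

theorem tendsto_exp_div_atTop : Tendsto (fun L : ℝ => Real.exp L / L) atTop atTop := by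
  simpa using Real.tendsto_exp_div_pow_atTop 1

theorem tendsto_exp_sub_exp_atBot :
    Tendsto (fun L : ℝ => Real.exp (L / 4) - Real.exp (L / 2)) atTop atBot := by
  have h1 : Tendsto (fun L : ℝ => Real.exp (L / 4)) atTop atTop :=
    Real.tendsto_exp_atTop.comp (tendsto_id.atTop_div_const (by norm_num))
  have h2 : Tendsto (fun x : ℝ => x * (1 - x)) atTop atBot :=
    tendsto_id.atTop_mul_atBot₀ (tendsto_atBot_add_const_left _ _ tendsto_neg_atTop_atBot)
  refine (h2.comp h1).congr fun L => ?_
  have : Real.exp (L / 2) = Real.exp (L / 4) * Real.exp (L / 4) := by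
    rw [← Real.exp_add]; congr 1; ring
  simp only [Function.comp_apply, this]
  ring

theorem tendsto_exp_neg_mul_mul_pow (m : ℕ) {b : ℝ} (hb : 0 < b) :
    Tendsto (fun L : ℝ => Real.exp (-b * L) * L ^ m) atTop (𝓝 0) := by
  refine ((isLittleO_pow_exp_pos_mul_atTop (k := m) hb).tendsto_div_nhds_zero).congr fun L => ?_
  rw [neg_mul, Real.exp_neg]
  ring

theorem tendsto_overlapRatio {θ : ℝ} (hθ : 0 < θ) :
    Tendsto (overlapRatio θ) atTop (𝓝 0) := by
  have h := (tendsto_exp_neg_mul_mul_pow 2 (half_pos hθ)).const_mul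
    (Real.exp 1 * (Real.exp 1 + 1))
  rwa [mul_zero] at h

theorem tendsto_secondMomentRatio {θ : ℝ} (hθ : 0 < θ) (hθ2 : θ < 2) :
    Tendsto (secondMomentRatio θ) atTop (𝓝 1) := by
  have h1 := (tendsto_exp_neg_mul_mul_pow 3 (b := 1 - θ / 2) (by linarith)).rexp
  have h2 := (tendsto_exp_neg_mul_mul_pow 1 (b := 1 / 3) (by norm_num)).rexp
  have h3 := (tendsto_overlapRatio hθ).div ((tendsto_overlapRatio hθ).const_sub 1) (by norm_num)
  have h := h1.mul (h2.add h3)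
  simp only [Real.exp_zero, sub_zero, zero_div, add_zero, mul_one] at h
  refine h.congr fun L => ?_
  simp only [secondMomentRatio, pow_one, neg_sub]
  rfl

/-! ### Sequences of graphs -/

section Sequences

variable {V : ℕ → Type u} [∀ l, Fintype (V l)] [∀ l, LinearOrder (V l)]
  {G : ∀ l, SimpleGraph (V l)} {κ : ℕ → ℕ}

theorem nonDPColorableWHP_of_le (hV : Tendsto (fun l => Fintype.card (V l)) atTop atTop)
    (hρ : Tendsto (fun l => (G l).maxDensity) atTop atTop) {ε : ℝ} (h0 : 0 < ε) (h1 : ε < 1)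
    (hκ : ∀ᶠ l in atTop,
      (κ l : ℝ) ≤ (1 - ε) * ((G l).maxDensity / Real.log (G l).maxDensity)) :
    NonDPColorableWHP G κ := by
  have hL : Tendsto (fun l => Real.log (G l).maxDensity) atTop atTop :=
    Real.tendsto_log_atTop.comp hρ
  have hc : 0 < ε / (1 - ε) := div_pos h0 (by linarith)
  have hlim : Tendsto (fun l => Real.exp (-(ε / (1 - ε)) * Real.log (G l).maxDensity))
      atTop (𝓝 0) :=
    Real.tendsto_exp_atBot.comp (hL.const_mul_atTop_of_neg (neg_lt_zero.2 hc))
  refine tendsto_of_tendsto_of_tendsto_of_le_of_le' tendsto_const_nhds hlim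
    (Eventually.of_forall fun l => dpColorableProb_nonneg) ?_
  filter_upwards [hκ, hL.eventually_ge_atTop 1, hρ.eventually_gt_atTop 0,
    hV.eventually_gt_atTop 0] with l hk hL1 hρ0 hV0
  have : Nonempty (V l) := Fintype.card_pos_iff.1 hV0
  refine dpColorableProb_le_exp h0 h1 hL1 (Real.exp_log hρ0).symm ?_
  rwa [Real.exp_log hρ0]

theorem dpColorableWHP_of_tendsto_log_div_log_log
    (hV : Tendsto (fun l => Fintype.card (V l)) atTop atTop)
    (hρ : Tendsto (fun l => (G l).maxDensity) atTop atTop)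
    (hlog : Tendsto (fun l => Real.log (G l).maxDensity /
      Real.log (Real.log (Fintype.card (V l) : ℝ))) atTop atTop)
    (hκ : ∀ᶠ l in atTop, 9 * ((G l).maxDensity / Real.log (G l).maxDensity) ≤ κ l) :
    DPColorableWHP G κ := by
  have hL : Tendsto (fun l => Real.log (G l).maxDensity) atTop atTop :=
    Real.tendsto_log_atTop.comp hρ
  have hlogn : Tendsto (fun l => Real.log (Fintype.card (V l) : ℝ)) atTop atTop :=
    Real.tendsto_log_atTop.comp (tendsto_natCast_atTop_atTop.comp hV)
  have hloglogn : Tendsto (fun l => Real.log (Real.log (Fintype.card (V l) : ℝ))) atTop atTop :=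
    Real.tendsto_log_atTop.comp hlogn
  have hexp4 : ∀ᶠ L : ℝ in atTop, L ≤ Real.exp (L / 4) := by
    have h : Tendsto (fun L : ℝ => Real.exp (L / 4) / (L / 4)) atTop atTop :=
      tendsto_exp_div_atTop.comp (tendsto_id.atTop_div_const (by norm_num))
    filter_upwards [h.eventually_ge_atTop 4, eventually_gt_atTop 0] with L h1 h2
    rw [le_div_iff₀ (by linarith)] at h1
    linarith
  have hlim : Tendsto (fun l => 1 - Real.exp (Real.exp (Real.log (G l).maxDensity / 4) -
      Real.exp (Real.log (G l).maxDensity / 2))) atTop (𝓝 1) := by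
    have h := (Real.tendsto_exp_atBot.comp (tendsto_exp_sub_exp_atBot.comp hL)).const_sub 1
    rwa [sub_zero] at h
  refine tendsto_of_tendsto_of_tendsto_of_le_of_le' hlim tendsto_const_nhds ?_
    (Eventually.of_forall fun l => dpColorableProb_le_one)
  filter_upwards [hκ, hL.eventually_ge_atTop 1, hρ.eventually_gt_atTop 0, hV.eventually_gt_atTop 0,
    hL.eventually hexp4, hlog.eventually_ge_atTop 4, hlogn.eventually_gt_atTop 0,
    hloglogn.eventually_gt_atTop 0] with l hk hL1 hρ0 hV0 hL4 hlog4 hlogn0 hloglogn0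
  refine one_sub_exp_le_dpColorableProb hL1 hL4 (Real.exp_log hρ0).symm hV0 ?_ ?_
  · rw [le_div_iff₀ hloglogn0] at hlog4
    rw [← Real.log_le_iff_le_exp hlogn0]
    linarith
  · rwa [Real.exp_log hρ0]

theorem dpColorableWHP_of_tendsto_log_div_log
    (hV : Tendsto (fun l => Fintype.card (V l)) atTop atTop)
    (hρ : Tendsto (fun l => (G l).maxDensity) atTop atTop)
    (hlog : Tendsto (fun l => Real.log (G l).maxDensity / Real.log (Fintype.card (V l) : ℝ))
      atTop (𝓝 1)) {ε : ℝ} (h0 : 0 < ε) (h1 : ε ≤ 1)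
    (hκ : ∀ᶠ l in atTop,
      (1 + ε) * ((G l).maxDensity / Real.log (G l).maxDensity) ≤ κ l) :
    DPColorableWHP G κ := by
  have hL : Tendsto (fun l => Real.log (G l).maxDensity) atTop atTop :=
    Real.tendsto_log_atTop.comp hρ
  have hlogn : Tendsto (fun l => Real.log (Fintype.card (V l) : ℝ)) atTop atTop :=
    Real.tendsto_log_atTop.comp (tendsto_natCast_atTop_atTop.comp hV)
  -- With this `θ` one has `(1 - θ) * (1 + ε / 2) = 1`.
  set θ : ℝ := ε / (2 + ε) with hθdef
  have hθ : 0 < θ := by positivity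
  have hθ3 : θ ≤ 1 / 3 := by
    rw [hθdef, div_le_div_iff₀ (by linarith) (by norm_num)]
    linarith
  have hθε : (1 - θ) * (1 + ε / 2) = 1 := by
    rw [hθdef]
    field_simp
    ring
  have hlim : Tendsto (fun l => 1 / secondMomentRatio θ (Real.log (G l).maxDensity))
      atTop (𝓝 1) := by
    have h := (tendsto_const_nhds (x := (1 : ℝ))).div
      ((tendsto_secondMomentRatio hθ (by linarith)).comp hL) one_ne_zero
    rwa [div_one] at h
  refine tendsto_of_tendsto_of_tendsto_of_le_of_le' hlim tendsto_const_nhds ?_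
    (Eventually.of_forall fun l => dpColorableProb_le_one)
  have hη : 1 / (1 + θ / 2) < 1 := by
    rw [div_lt_one (by linarith)]
    linarith
  filter_upwards [hκ, hL.eventually_ge_atTop 1, hρ.eventually_gt_atTop 0, hV.eventually_gt_atTop 0,
    hlogn.eventually_gt_atTop 0, hlog.eventually (lt_mem_nhds hη),
    (tendsto_exp_div_atTop.comp hL).eventually_ge_atTop (2 / ε),
    (tendsto_exp_div_atTop.comp hL).eventually_ge_atTop 1,
    ((tendsto_overlapRatio hθ).comp hL).eventually (gt_mem_nhds one_pos)]
    with l hk hL1 hρ0 hV0 hlogn0 hlogη ht ht1 hq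
  simp only [Function.comp_apply] at ht ht1 hq
  rw [← Real.exp_log hρ0, Real.log_exp] at hk
  set L := Real.log (G l).maxDensity with hLdef
  have hLp : 0 < L := by linarith
  rw [div_le_iff₀ h0] at ht
  have hK : (1 + ε / 2) * (Real.exp L / L) ≤ κ l - 1 := by linarith
  have hK1 : (1 : ℝ) ≤ κ l - 1 := by nlinarith
  have hk2 : 2 ≤ κ l := by
    have : (2 : ℝ) ≤ κ l := by linarith
    exact_mod_cast this
  have hn : (Fintype.card (V l) : ℝ) ≤ Real.exp ((1 + θ / 2) * L) := by
    rw [← Real.log_le_iff_le_exp (by exact_mod_cast hV0)]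
    rw [div_lt_div_iff₀ (by linarith) hlogn0] at hlogη
    linarith
  have hmain := one_le_dpColorableProb_mul_secondMomentRatio hθ hθ3 hL1 (Real.exp_log hρ0).symm
    (k := κ l) ?_ hk2 hn hq
  · have hF : 0 < secondMomentRatio θ L := by
      by_contra hF
      have := mul_nonpos_of_nonneg_of_nonpos
        (dpColorableProb_nonneg (G := G l) (k := κ l)) (not_lt.1 hF)
      linarith
    rwa [div_le_iff₀ hF]
  · have h2 := mul_le_mul_of_nonneg_left hK (show 0 ≤ (1 - θ) * L by nlinarith)
    refine le_trans (le_of_eq ?_) h2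
    calc Real.exp L = 1 * (L * (Real.exp L / L)) := by field_simp
      _ = ((1 - θ) * (1 + ε / 2)) * (L * (Real.exp L / L)) := by rw [hθε]
      _ = _ := by ring

end Sequences

theorem theorem5p1 {V : ℕ → Type u} [∀ l, Fintype (V l)] [∀ l, LinearOrder (V l)]
    (G : ∀ l, SimpleGraph (V l))
    (hV : Tendsto (fun l => Fintype.card (V l)) atTop atTop)
    (hρ : Tendsto (fun l => (G l).maxDensity) atTop atTop) :
    (Tendsto (fun l => Real.log (G l).maxDensity / Real.log (Real.log (Fintype.card (V l) : ℝ)))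
        atTop atTop →
      IsDPThreshold G (fun l => (G l).maxDensity / Real.log (G l).maxDensity)) ∧
    (Tendsto (fun l => Real.log (G l).maxDensity / Real.log (Fintype.card (V l) : ℝ))
        atTop (𝓝 1) →
      IsSharpDPThreshold G (fun l => (G l).maxDensity / Real.log (G l).maxDensity)) := by
  have hL : Tendsto (fun l => Real.log (G l).maxDensity) atTop atTop :=
    Real.tendsto_log_atTop.comp hρ
  have ht : ∀ᶠ l in atTop, 0 < (G l).maxDensity / Real.log (G l).maxDensity := by
    filter_upwards [hρ.eventually_gt_atTop 0, hL.eventually_gt_atTop 0] with l h1 h2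
    exact div_pos h1 h2
  refine ⟨fun hlog κ => ⟨fun hκ => ?_, fun hκ => ?_⟩,
    fun hlog ε hε κ => ⟨fun hκ => ?_, fun hκ => ?_⟩⟩
  · refine nonDPColorableWHP_of_le hV hρ (ε := 1 / 2) (by norm_num) (by norm_num) ?_
    filter_upwards [hκ.def (show (0 : ℝ) < 1 / 2 by norm_num), ht] with l h h0
    rw [Real.norm_of_nonneg (Nat.cast_nonneg _), Real.norm_of_nonneg h0.le] at h
    linarith
  · refine dpColorableWHP_of_tendsto_log_div_log_log hV hρ hlog ?_
    filter_upwards [hκ.def (show (0 : ℝ) < 1 / 9 by norm_num), ht] with l h h0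
    rw [Real.norm_of_nonneg (Nat.cast_nonneg _), Real.norm_of_nonneg h0.le] at h
    linarith
  · refine nonDPColorableWHP_of_le hV hρ (ε := min ε (1 / 2)) (by positivity)
      (min_lt_of_right_lt (by norm_num)) ?_
    filter_upwards [hκ, ht] with l h h0
    refine h.trans (mul_le_mul_of_nonneg_right ?_ h0.le)
    linarith [min_le_left ε (1 / 2)]
  · refine dpColorableWHP_of_tendsto_log_div_log hV hρ hlog (ε := min ε 1) (by positivity)
      (min_le_right _ _) ?_
    filter_upwards [hκ, ht] with l h h0
    refine le_trans (mul_le_mul_of_nonneg_right ?_ h0.le) h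
    linarith [min_le_left ε 1]
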